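/- Let $\mathfrak H=L^2(\mathbb R^d)$, let $\mathfrak H^n\subset L^2((\mathbb R^d)^n)$ be the space of antisymmetric (fermions) or of symmetric (bosons) wavefunctions, with $\mathfrak H^0=\mathbb C$, and let $\mathcal F^{\le N}=\bigoplus_{n=0}^N\mathfrak H^n$ be the truncated Fock space, with number operator $\mathcal N=\bigoplus_{n=0}^N n$. A state on $\mathcal F^{\le N}$ is a non-negative self-adjoint trace-class operator $\Gamma$ with $\operatorname{tr}\Gamma=1$. For $f\in\mathfrak H$ and $\psi\in\mathfrak H^n$ put $$a^\dagger(f)\psi=f\circ\psi:=\frac{1}{\sqrt{n!\,(n+1)!}}\sum_{\sigma\in\mathcal S_{n+1}}\varepsilon(\sigma)\,f(x_{\sigma(1)})\,\psi(x_{\sigma(2)},\dots,x_{\sigma(n+1)}),$$ where $\varepsilon=\mathrm{sgn}$ for fermions ($\circ=\wedge$) and $\varepsilon=1$ for bosons ($\circ=\vee$); let $a(f)$ be the adjoint of $a^\dagger(f)$, and let $f_1\circ\cdots\circ f_q=a^\dagger(f_1)\cdots a^\dagger(f_q)\Omega$ with $\Omega=1\in\mathfrak H^0$ the vacuum. For a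 state $\Gamma$ on $\mathcal F^{\le N}$ (extended by $0$ to the full Fock space) and $0\le p,q\le N$, the density matrix $[\Gamma]^{(p,q)}$ is the unique bounded operator $\mathfrak H^q\to\mathfrak H^p$ such that, for all $f_1,\dots,f_q,g_1,\dots,g_p\in\mathfrak H$, $$\big\langle g_1\circ\cdots\circ g_p,[\Gamma]^{(p,q)}f_1\circ\cdots\circ f_q\big\rangle=\operatorname{tr}\big(\Gamma\,a^\dagger(f_1)\cdots a^\dagger(f_q)\,a(g_p)\cdots a(g_1)\big).$$ States $\Gamma_n$ converge geometrically to a state $\Gamma$ on $\mathcal F^{\le N}$ if $$\lim_{n\to\infty}\langle\psi,[\Gamma_n]^{(p,q)}\psi'\rangle=\langle\psi,[\Gamma]^{(p,q)}\psi'\rangle\quad\text{for all }0\le p,q\le N,\ \psi\in\mathfrak H^p,\ \psi'\in\mathfrak H^q.$$ **Lemma (average particle number and strong convergence).** Consider fermions or bosons. Let $(\Gamma_n)$ be a sequence of states on $\mathcal F^{\le N}$ which converges geometrically to a state $\Gamma$ on $\mathcal F^{\le N}$. Then $$\operatorname{tr}(\mathcal N\Gamma)\le\liminf_{n\to\infty}\operatorname{tr}(\mathcal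 N\Gamma_n).$$ Furthermore, if $\lim_{n\to\infty}\operatorname{tr}(\mathcal N\Gamma_n)=\operatorname{tr}(\mathcal N\Gamma)$, then $\Gamma_n\to\Gamma$ strongly in the trace class, that is $\operatorname{tr}|\Gamma_n-\Gamma|\to0$. -/

import Mathlib

open MeasureTheory Filter Topology

noncomputable section

namespace ManyBody

/-! ### Trace, trace norm and states on a Hilbert space -/

section Trace

variable {H : Type*} [NormedAddCommGroup H] [InnerProductSpace ℂ H] [CompleteSpace H]

variable (H) in
/-- The index set of a chosen orthonormal (Hilbert) basis of `H`. -/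
def basisIndex : Set H := (exists_hilbertBasis ℂ H).choose

variable (H) in
/-- A chosen orthonormal (Hilbert) basis of `H`. Traces do not depend on it. -/
def basis : HilbertBasis (basisIndex H) ℂ H := (exists_hilbertBasis ℂ H).choose_spec.choose

/-- `tr T = ∑ᵢ ⟨eᵢ, T eᵢ⟩`; used for trace-class operators only. -/
def trace (T : H →L[ℂ] H) : ℂ := ∑' i, inner ℂ (basis H i) (T (basis H i))

/-- The trace norm `‖T‖_{𝔖₁} = tr |T|`, with `|T| = √(T* T)`, as an element of `[0, ∞]`. -/
def traceNorm (T : H →L[ℂ] H) : ENNReal :=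
  ∑' i, ENNReal.ofReal (inner ℂ (basis H i) (CFC.abs T (basis H i))).re

/-- `T` belongs to the trace class `𝔖₁(H)`. -/
def IsTraceClass (T : H →L[ℂ] H) : Prop := traceNorm T < ⊤

/-- Mixed states: non-negative self-adjoint trace-class operators of trace one. -/
structure IsState (Γ : H →L[ℂ] H) : Prop where
  isPositive : Γ.IsPositive
  isTraceClass : IsTraceClass Γ
  trace_eq_one : trace Γ = 1

end Trace

/-! ### The `n`-particle spaces -/

/-- The one-particle configuration space `ℝᵈ`. -/
abbrev Pos (d : ℕ) := EuclideanSpace ℝ (Fin d)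

/-- The one-particle space `𝔥 = L²(ℝᵈ)`. -/
abbrev OneBody (d : ℕ) := Lp ℂ 2 (volume : Measure (Pos d))

/-- `L²((ℝᵈ)ⁿ)`, without any symmetry. -/
abbrev L2 (d n : ℕ) := Lp ℂ 2 (volume : Measure (Fin n → Pos d))

/-- The two kinds of statistics. -/
inductive Statistics
  | fermions
  | bosons

/-- The factor picked up by a wavefunction when its variables are permuted by `σ`: the signature
for fermions and `1` for bosons. -/
def Statistics.sign (s : Statistics) {n : ℕ} (σ : Equiv.Perm (Fin n)) : ℂ :=
  match s with
  | .fermions => ((Equiv.Perm.sign σ : ℤ) : ℂ)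
  | .bosons => 1

lemma Statistics.sign_mul (s : Statistics) {n : ℕ} (σ τ : Equiv.Perm (Fin n)) :
    s.sign (σ * τ) = s.sign σ * s.sign τ := by
  cases s <;> simp [Statistics.sign]

lemma Statistics.sign_mul_self (s : Statistics) {n : ℕ} (σ : Equiv.Perm (Fin n)) :
    s.sign σ * s.sign σ = 1 := by
  cases s
  · simp only [Statistics.sign]
    rcases Int.units_eq_one_or (Equiv.Perm.sign σ) with h | h <;> simp [h]
  · simp [Statistics.sign]

lemma measurePreserving_permute (d : ℕ) {n : ℕ} (σ : Equiv.Perm (Fin n)) :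
    MeasurePreserving (fun x : Fin n → Pos d => fun i => x (σ i)) volume volume := by
  have h := volume_measurePreserving_piCongrLeft (fun _ : Fin n => Pos d) σ.symm
  convert h using 1
  ext x i : 2
  have := MeasurableEquiv.piCongrLeft_apply_apply (β := fun _ : Fin n => Pos d) σ.symm x (σ i)
  simpa using this.symm

/-- Permutation of variables: `(permute σ ψ)(x₁, …, xₙ) = ψ(x_{σ(1)}, …, x_{σ(n)})`. -/
def permute (d : ℕ) {n : ℕ} (σ : Equiv.Perm (Fin n)) : L2 d n →ₗᵢ[ℂ] L2 d n :=
  Lp.compMeasurePreservingₗᵢ ℂ (fun x i => x (σ i)) (measurePreserving_permute d σ)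

lemma permute_ae (d : ℕ) {n : ℕ} (σ : Equiv.Perm (Fin n)) (ψ : L2 d n) :
    permute d σ ψ =ᵐ[volume] fun x => ψ (fun i => x (σ i)) :=
  Lp.coeFn_compMeasurePreserving ψ (measurePreserving_permute d σ)

lemma permute_permute (d : ℕ) {n : ℕ} (σ τ : Equiv.Perm (Fin n)) (ψ : L2 d n) :
    permute d τ (permute d σ ψ) = permute d (τ * σ) ψ := by
  apply Lp.ext
  have h1 := permute_ae d τ (permute d σ ψ)
  have h2 := (measurePreserving_permute d τ).quasiMeasurePreserving.ae_eq_comp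
    (permute_ae d σ ψ)
  have h3 := permute_ae d (τ * σ) ψ
  filter_upwards [h1, h2, h3] with x a b c
  rw [a, c]
  exact b

/-- The subspace of (anti)symmetric wavefunctions in `L²((ℝᵈ)ⁿ)`. -/
def symmetricSubspace (s : Statistics) (d n : ℕ) : Submodule ℂ (L2 d n) where
  carrier := {ψ | ∀ σ : Equiv.Perm (Fin n), permute d σ ψ = s.sign σ • ψ}
  add_mem' {a b} ha hb σ := by rw [map_add, ha σ, hb σ, smul_add]
  zero_mem' σ := by simp
  smul_mem' c a ha σ := by rw [map_smul, ha σ, smul_comm]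

lemma isClosed_symmetricSubspace (s : Statistics) (d n : ℕ) :
    IsClosed (symmetricSubspace s d n : Set (L2 d n)) := by
  have : (symmetricSubspace s d n : Set (L2 d n)) =
      ⋂ σ : Equiv.Perm (Fin n), {ψ | permute d σ ψ = s.sign σ • ψ} := by
    ext ψ; simp [symmetricSubspace]
  rw [this]
  exact isClosed_iInter fun σ =>
    isClosed_eq (permute d σ).continuous (continuous_const_smul _)

/-- The Hilbert space `𝔥ⁿ_{a/s}` of `n` fermions or bosons. -/
def Sector (s : Statistics) (d n : ℕ) : Type := symmetricSubspace s d n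

instance (s : Statistics) (d n : ℕ) : NormedAddCommGroup (Sector s d n) :=
  inferInstanceAs (NormedAddCommGroup (symmetricSubspace s d n))

instance (s : Statistics) (d n : ℕ) : InnerProductSpace ℂ (Sector s d n) :=
  inferInstanceAs (InnerProductSpace ℂ (symmetricSubspace s d n))

instance (s : Statistics) (d n : ℕ) : CompleteSpace (Sector s d n) :=
  (isClosed_symmetricSubspace s d n).completeSpace_coe

/-! ### Tensor products and creation operators -/

/-- The function `(x₀, x₁, …, xₙ) ↦ f(x₀) ψ(x₁, …, xₙ)`. -/
def tensorFun {d n : ℕ} (f : OneBody d) (ψ : L2 d n) : (Fin (n + 1) → Pos d) → ℂ :=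
  fun x => f (x 0) * ψ (fun i => x i.succ)

lemma measurePreserving_split (d n : ℕ) :
    MeasurePreserving (fun x : Fin (n + 1) → Pos d => (x 0, fun i : Fin n => x i.succ))
      volume (volume.prod volume) := by
  have h := volume_preserving_piFinSuccAbove (fun _ : Fin (n + 1) => Pos d) 0
  exact h

lemma aestronglyMeasurable_mul {d n : ℕ} (f : OneBody d) (ψ : L2 d n) :
    AEStronglyMeasurable (fun z : Pos d × (Fin n → Pos d) => f z.1 * ψ z.2)
      (volume.prod volume) :=
  (Lp.aestronglyMeasurable f).comp_fst.mul (Lp.aestronglyMeasurable ψ).comp_snd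

lemma eLpNorm_tensorFun {d n : ℕ} (f : OneBody d) (ψ : L2 d n) :
    eLpNorm (tensorFun f ψ) 2 volume = eLpNorm f 2 volume * eLpNorm ψ 2 volume := by
  have h1 : eLpNorm (tensorFun f ψ) 2 volume =
      eLpNorm (fun z : Pos d × (Fin n → Pos d) => f z.1 * ψ z.2) 2 (volume.prod volume) := by
    have h0 : tensorFun f ψ = (fun z : Pos d × (Fin n → Pos d) => f z.1 * ψ z.2) ∘
      (fun x : Fin (n + 1) → Pos d => (x 0, fun i : Fin n => x i.succ)) := rfl
    rw [h0]
    exact eLpNorm_comp_measurePreserving (f := fun x : Fin (n + 1) → Pos d =>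
      (x 0, fun i : Fin n => x i.succ)) (aestronglyMeasurable_mul f ψ)
      (measurePreserving_split d n)
  rw [h1]
  simp only [eLpNorm_eq_lintegral_rpow_enorm_toReal (p := 2) (by norm_num) (by norm_num)]
  rw [← ENNReal.mul_rpow_of_nonneg _ _ (by norm_num)]
  congr 1
  rw [← lintegral_prod_mul]
  · congr 1
    ext z
    rw [enorm_mul, ENNReal.mul_rpow_of_nonneg _ _ (by norm_num)]
  · exact (Lp.aestronglyMeasurable f).enorm.pow_const _
  · exact (Lp.aestronglyMeasurable ψ).enorm.pow_const _

lemma memLp_tensorFun {d n : ℕ} (f : OneBody d) (ψ : L2 d n) :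
    MemLp (tensorFun f ψ) 2 volume := by
  refine ⟨(aestronglyMeasurable_mul f ψ).comp_measurePreserving (measurePreserving_split d n), ?_⟩
  rw [eLpNorm_tensorFun]
  exact ENNReal.mul_lt_top (Lp.eLpNorm_lt_top f) (Lp.eLpNorm_lt_top ψ)

lemma ae_tail {d n : ℕ} {p : (Fin n → Pos d) → Prop} (h : ∀ᵐ y, p y) :
    ∀ᵐ x : Fin (n + 1) → Pos d, p (fun i => x i.succ) :=
  (Measure.quasiMeasurePreserving_snd.comp
    (measurePreserving_split d n).quasiMeasurePreserving).ae h

/-- The tensor product `ψ ↦ f ⊗ ψ`, from `L²((ℝᵈ)ⁿ)` to `L²((ℝᵈ)ⁿ⁺¹)`. -/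
def tensor {d n : ℕ} (f : OneBody d) : L2 d n →L[ℂ] L2 d (n + 1) :=
  LinearMap.mkContinuous
    { toFun := fun ψ => (memLp_tensorFun f ψ).toLp
      map_add' := fun ψ φ => by
        apply Lp.ext
        filter_upwards [(memLp_tensorFun f (ψ + φ)).coeFn_toLp, (memLp_tensorFun f ψ).coeFn_toLp,
          (memLp_tensorFun f φ).coeFn_toLp, ae_tail (Lp.coeFn_add ψ φ),
          Lp.coeFn_add (memLp_tensorFun f ψ).toLp (memLp_tensorFun f φ).toLp] with x a b c e g
        rw [a, g, Pi.add_apply, b, c]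
        simp only [tensorFun, e, Pi.add_apply, mul_add]
      map_smul' := fun k ψ => by
        apply Lp.ext
        filter_upwards [(memLp_tensorFun f (k • ψ)).coeFn_toLp, (memLp_tensorFun f ψ).coeFn_toLp,
          ae_tail (Lp.coeFn_smul k ψ), Lp.coeFn_smul k (memLp_tensorFun f ψ).toLp] with x a b e g
        rw [a, RingHom.id_apply, g, Pi.smul_apply, b]
        simp only [tensorFun, e, Pi.smul_apply, smul_eq_mul]
        ring }
    ‖f‖ fun ψ => by
      simp only [LinearMap.coe_mk, AddHom.coe_mk]
      rw [Lp.norm_toLp, eLpNorm_tensorFun, ENNReal.toReal_mul, ← Lp.norm_def, ← Lp.norm_def]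

/-- The (anti)symmetric product of a one-body and an `n`-body wavefunction,
`(f ∘ ψ)(x) = (1! n! (n+1)!)^{-1/2} ∑_σ ε(σ) f(x_{σ(0)}) ψ(x_{σ(1)}, …, x_{σ(n)})`, with `ε(σ)` the
signature for fermions (`f ∧ ψ`) and `1` for bosons (`f ∨ ψ`). -/
def prodL2 (s : Statistics) {d n : ℕ} (f : OneBody d) : L2 d n →L[ℂ] L2 d (n + 1) :=
  ((Real.sqrt (Nat.factorial 1 * Nat.factorial n * Nat.factorial (n + 1)) : ℂ)⁻¹) •
    ∑ σ : Equiv.Perm (Fin (n + 1)),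
      s.sign σ • (permute d σ).toContinuousLinearMap.comp (tensor f)

lemma prodL2_mem (s : Statistics) {d n : ℕ} (f : OneBody d) (ψ : L2 d n) :
    prodL2 s f ψ ∈ symmetricSubspace s d (n + 1) := by
  intro τ
  simp only [prodL2, _root_.smul_apply, _root_.sum_apply,
    ContinuousLinearMap.comp_apply, LinearIsometry.coe_toContinuousLinearMap, map_smul, map_sum,
    permute_permute]
  rw [smul_comm (s.sign τ), Finset.smul_sum (r := s.sign τ)]
  congr 1
  refine Fintype.sum_equiv (Equiv.mulLeft τ) _ _ fun σ => ?_
  rw [Equiv.coe_mulLeft, Statistics.sign_mul, smul_smul, ← mul_assoc, s.sign_mul_self, one_mul]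

/-- The inclusion of `𝔥ⁿ_{a/s}` into `L²((ℝᵈ)ⁿ)`. -/
def toL2 (s : Statistics) (d n : ℕ) : Sector s d n →L[ℂ] L2 d n :=
  (symmetricSubspace s d n).subtypeL

/-- The creation operator `a†(f) : 𝔥ⁿ → 𝔥ⁿ⁺¹`, `ψ ↦ f ∘ ψ`. -/
def createSector (s : Statistics) (d n : ℕ) (f : OneBody d) :
    Sector s d n →L[ℂ] Sector s d (n + 1) :=
  ContinuousLinearMap.codRestrict ((prodL2 s f).comp (toL2 s d n))
    (symmetricSubspace s d (n + 1)) fun ψ => by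
      rw [ContinuousLinearMap.comp_apply]
      exact prodL2_mem s f (toL2 s d n ψ)

/-! ### The truncated Fock space -/

/-- The truncated Fock space `ℱ^{≤N} = ℂ ⊕ 𝔥¹ ⊕ ⋯ ⊕ 𝔥ᴺ` (Hilbert sum; the sector `n = 0` is
`L²` of a point). -/
def Fock (s : Statistics) (d N : ℕ) : Type := PiLp 2 fun n : Fin (N + 1) => Sector s d n

instance (s : Statistics) (d N : ℕ) : NormedAddCommGroup (Fock s d N) :=
  inferInstanceAs (NormedAddCommGroup (PiLp 2 fun n : Fin (N + 1) => Sector s d n))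

instance (s : Statistics) (d N : ℕ) : InnerProductSpace ℂ (Fock s d N) :=
  inferInstanceAs (InnerProductSpace ℂ (PiLp 2 fun n : Fin (N + 1) => Sector s d n))

instance (s : Statistics) (d N : ℕ) : CompleteSpace (Fock s d N) :=
  inferInstanceAs (CompleteSpace (PiLp 2 fun n : Fin (N + 1) => Sector s d n))

/-- The list of components of a vector of `ℱ^{≤N}`. -/
def components (s : Statistics) (d N : ℕ) :
    Fock s d N ≃L[ℂ] (∀ n : Fin (N + 1), Sector s d n) :=
  PiLp.continuousLinearEquiv 2 ℂ fun n : Fin (N + 1) => Sector s d n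

/-- The projection of `ℱ^{≤N}` onto its `n`-particle component. -/
def component (s : Statistics) (d N : ℕ) (n : Fin (N + 1)) : Fock s d N →L[ℂ] Sector s d n :=
  (ContinuousLinearMap.proj n).comp (components s d N).toContinuousLinearMap

/-- The inclusion of the `n`-particle space into `ℱ^{≤N}`. -/
def inclusion (s : Statistics) (d N : ℕ) (n : Fin (N + 1)) : Sector s d n →L[ℂ] Fock s d N :=
  (components s d N).symm.toContinuousLinearMap.comp
    (ContinuousLinearMap.single ℂ (fun n : Fin (N + 1) => Sector s d n) n)

/-- The creation operator `a†(f)` on `ℱ^{≤N}`, followed by the projection onto `ℱ^{≤N}` (it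
kills the `N`-particle sector). In `tr(Γ a†(f₁) ⋯ a†(f_q) a(g_p) ⋯ a(g₁))` with `Γ` living on
`ℱ^{≤N}` this gives the same value as the creation operators of the full Fock space: what has
left `ℱ^{≤N}` is never brought back by a creation operator, and is killed by `Γ`. -/
def create (s : Statistics) (d N : ℕ) (f : OneBody d) : Fock s d N →L[ℂ] Fock s d N :=
  ∑ n : Fin N, (inclusion s d N n.succ).comp
    ((createSector s d n f).comp (component s d N n.castSucc))

/-- The annihilation operator `a(f)` on `ℱ^{≤N}`, the adjoint of `a†(f)`. -/
def annihilate (s : Statistics) (d N : ℕ) (f : OneBody d) : Fock s d N →L[ℂ] Fock s d N :=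
  ContinuousLinearMap.adjoint (create s d N f)

/-- The number operator `𝒩 = 0 ⊕ 1 ⊕ ⋯ ⊕ N` on `ℱ^{≤N}`. -/
def number (s : Statistics) (d N : ℕ) : Fock s d N →L[ℂ] Fock s d N :=
  ∑ n : Fin (N + 1), ((n : ℕ) : ℂ) • (inclusion s d N n).comp (component s d N n)

/-- The average particle number `tr(𝒩 Γ)`. -/
def averageNumber {s : Statistics} {d N : ℕ} (Γ : Fock s d N →L[ℂ] Fock s d N) : ℝ :=
  (trace (number s d N ∘L Γ)).re

/-! ### Density matrices and geometric convergence -/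

/-- The constant function `1` on the one-point space `(ℝᵈ)⁰`. -/
def vacuum (s : Statistics) (d : ℕ) : Sector s d 0 :=
  ⟨(show MemLp (fun _ : Fin 0 → Pos d => (1 : ℂ)) 2 volume by
      rw [volume_pi, Measure.pi_of_empty]
      exact memLp_const 1).toLp, fun σ => by
    have hσ : σ = 1 := Subsingleton.elim _ _
    subst hσ
    have h1 : s.sign (1 : Equiv.Perm (Fin 0)) = 1 := by cases s <;> simp [Statistics.sign]
    rw [h1, one_smul]
    apply Lp.ext
    filter_upwards [permute_ae d (1 : Equiv.Perm (Fin 0)) _] with x hx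
    rw [hx]
    rfl⟩

/-- The product `f₁ ∘ ⋯ ∘ f_q ∈ 𝔥^q` of one-body functions, with `∘ = ∧` for fermions and
`∘ = ∨` for bosons. -/
def product (s : Statistics) (d : ℕ) : (q : ℕ) → (Fin q → OneBody d) → Sector s d q
  | 0, _ => vacuum s d
  | q + 1, f => createSector s d q (f 0) (product s d q fun i => f i.succ)

/-- `a†(f₁) ⋯ a†(f_q) a(g_p) ⋯ a(g₁)`. -/
def normalOrdered (s : Statistics) (d N : ℕ) {p q : ℕ} (f : Fin q → OneBody d)
    (g : Fin p → OneBody d) : Fock s d N →L[ℂ] Fock s d N :=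
  (List.ofFn fun i => create s d N (f i)).prod *
    (List.ofFn fun i => annihilate s d N (g i)).reverse.prod

/-- The relation which defines the density matrix `[Γ]^{(p,q)} : 𝔥^q → 𝔥^p`:
`⟨g₁ ∘ ⋯ ∘ g_p, D f₁ ∘ ⋯ ∘ f_q⟩ = tr(Γ a†(f₁) ⋯ a†(f_q) a(g_p) ⋯ a(g₁))` for all one-body
functions. -/
def IsDensityMatrix {s : Statistics} {d N : ℕ} (Γ : Fock s d N →L[ℂ] Fock s d N) (p q : ℕ)
    (D : Sector s d q →L[ℂ] Sector s d p) : Prop :=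
  ∀ (f : Fin q → OneBody d) (g : Fin p → OneBody d),
    inner ℂ (product s d p g) (D (product s d q f)) = trace (Γ ∘L normalOrdered s d N f g)

open Classical in
/-- The density matrix `[Γ]^{(p,q)}`: the bounded operator characterized by its defining
relation. For every trace-class `Γ` there is exactly one (products of one-body functions span a
dense subspace), so the value `0` is never used for a state. -/
def densityMatrix {s : Statistics} {d N : ℕ} (Γ : Fock s d N →L[ℂ] Fock s d N) (p q : ℕ) :
    Sector s d q →L[ℂ] Sector s d p :=
  if h : ∃ D, IsDensityMatrix Γ p q D then h.choose else 0

/-- Geometric convergence `Γₙ ⇀_g Γ`: `⟨ψ, [Γₙ]^{(p,q)} ψ'⟩ → ⟨ψ, [Γ]^{(p,q)} ψ'⟩` for all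
`ψ ∈ 𝔥^p`, `ψ' ∈ 𝔥^q` and all `0 ≤ p, q ≤ N`. -/
def GeometricallyConverges {s : Statistics} {d N : ℕ} (Γn : ℕ → Fock s d N →L[ℂ] Fock s d N)
    (Γ : Fock s d N →L[ℂ] Fock s d N) : Prop :=
  ∀ p ≤ N, ∀ q ≤ N, ∀ (ψ : Sector s d p) (ψ' : Sector s d q),
    Tendsto (fun n => inner ℂ ψ (densityMatrix (Γn n) p q ψ')) atTop
      (𝓝 (inner ℂ ψ (densityMatrix Γ p q ψ')))

end ManyBody

end

noncomputable section
namespace ManyBody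

/-! For an orthonormal basis `hⱼ` of the one-body space, `tr(𝒩 Γ) = ∑ⱼ tr(Γ a†(hⱼ) a(hⱼ))`
(`IsState.hasSum_averageNumber`). The terms are non-negative and each passes to the geometric limit,
so Fatou's lemma gives the inequality. If the averages also converge, no mass of the series is lost,
and the occupation numbers can serve as dominating terms in a dominated convergence argument
(`tendsto_tsum_of_dominated_of_tendsto`).

For the second part it suffices to prove weak convergence: among states it implies convergence in
trace norm when the limit is again a state, because a finite-rank cutoff then captures almost all
the mass of `Γ`, hence of `Γₙ` (`tendsto_traceNorm_sub`). By boundedness, weak convergence need only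
be tested on the vectors `a†(f₁) ⋯ a†(f_q) Ω`, which are total. Such matrix elements are
expectations of `a†(f₁) ⋯ a†(f_q) φ(𝒩) a(g_p) ⋯ a(g₁)`, where `φ` is the indicator of `0`, so that
`φ(𝒩)` is the projection onto the vacuum.

These expectations converge for every `φ` (`GeometricallyConverges.tendsto_trace_numberFun`). One
writes `φ(𝒩) = φ(0) + ∑ⱼ a†(hⱼ) χ(𝒩) a(hⱼ)` with `χ(n) = (φ(n+1) - φ(0))/(n+1)`. The constant gives
a normal-ordered product, covered by geometric convergence. Each term of the series has one more
creation and one more annihilation operator; it is bounded by a constant times the occupation of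
`hⱼ`, so the limit goes under the sum. The recursion ends because more than `N` creation operators
multiply to zero on the truncated space.

The same recursion, run on vectors with ever fewer particles, produces the density matrices as
bounded operators (`exists_densityMatrix_vector`), so that the default value in their definition
never occurs. -/

/-! ### Sums -/

/-- Dominated convergence for sums, with a converging sequence of dominating sums. -/
lemma tendsto_tsum_of_dominated_of_tendsto {ι : Type*} {x : ℕ → ι → ℝ} {x' : ι → ℝ}
    {X : ℕ → ℝ} {X' : ℝ} {y : ℕ → ι → ℂ} {y' : ι → ℂ} {K : ℝ}
    (hK : 0 ≤ K) (hx : ∀ n, HasSum (x n) (X n)) (hx' : HasSum x' X')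
    (hlim : ∀ i, Tendsto (fun n => x n i) atTop (𝓝 (x' i))) (hX : Tendsto X atTop (𝓝 X'))
    (hy : ∀ n i, ‖y n i‖ ≤ K * x n i) (hy' : ∀ i, ‖y' i‖ ≤ K * x' i)
    (hylim : ∀ i, Tendsto (fun n => y n i) atTop (𝓝 (y' i))) :
    Tendsto (fun n => ∑' i, y n i) atTop (𝓝 (∑' i, y' i)) := by
  have hsy : ∀ n, Summable (y n) := fun n =>
    Summable.of_norm_bounded ((hx n).summable.mul_left K) (hy n)
  have hsy' : Summable y' := Summable.of_norm_bounded (hx'.summable.mul_left K) hy'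
  have tail : ∀ (F : Finset ι) (z : ι → ℂ) (w : ι → ℝ) (W : ℝ), HasSum w W →
      (∀ i, ‖z i‖ ≤ K * w i) →
      ‖∑' i, z i - ∑ i ∈ F, z i‖ ≤ K * (W - ∑ i ∈ F, w i) := by
    intro F z w W hw hz
    have hz' : Summable z := Summable.of_norm_bounded (hw.summable.mul_left K) hz
    have h1 := hz'.sum_add_tsum_compl (s := F)
    have h2 := hw.summable.sum_add_tsum_compl (s := F)
    rw [hw.tsum_eq] at h2
    have h3 : ∑' i, z i - ∑ i ∈ F, z i = ∑' i : ↑((F : Set ι)ᶜ), z i := by rw [← h1]; ring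
    have h4 : W - ∑ i ∈ F, w i = ∑' i : ↑((F : Set ι)ᶜ), w i := by rw [← h2]; ring
    rw [h3, h4]
    refine tsum_of_norm_bounded ?_ fun i : ↑((F : Set ι)ᶜ) => hz i
    exact (hw.summable.subtype _).hasSum.mul_left K
  rw [Metric.tendsto_atTop]
  intro ε hε
  set δ := ε / (3 * (|K| + 1)) with hδ
  have hKp : 0 < 3 * (|K| + 1) := by positivity
  have hδp : 0 < δ := by positivity
  have hKδ : |K| * δ < ε / 3 := by
    have : (|K| + 1) * δ = ε / 3 := by rw [hδ]; field_simp
    nlinarith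
  -- `F` carries all but `δ` of the limiting mass. Since the totals `X n` converge to `X'`, the mass
  -- of `x n` outside `F` is also eventually below `δ`: nothing escapes along the index set.
  obtain ⟨F, hF⟩ := (hx'.eventually (lt_mem_nhds (show X' - δ < X' by linarith))).exists
  have hev1 : ∀ᶠ n in atTop, X n - ∑ i ∈ F, x n i < δ := by
    have : Tendsto (fun n => X n - ∑ i ∈ F, x n i) atTop (𝓝 (X' - ∑ i ∈ F, x' i)) :=
      hX.sub (tendsto_finsetSum _ fun i _ => hlim i)
    exact this.eventually (gt_mem_nhds (by linarith))
  have hev2 : ∀ᶠ n in atTop, ‖∑ i ∈ F, y n i - ∑ i ∈ F, y' i‖ < ε / 3 := by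
    have : Tendsto (fun n => ∑ i ∈ F, y n i) atTop (𝓝 (∑ i ∈ F, y' i)) :=
      tendsto_finsetSum _ fun i _ => hylim i
    have := (tendsto_iff_norm_sub_tendsto_zero.1 this).eventually
      (gt_mem_nhds (show (0 : ℝ) < ε / 3 by positivity))
    exact this
  obtain ⟨M, hM⟩ := eventually_atTop.1 (hev1.and hev2)
  have small : ∀ u : ℝ, u < δ → K * u < ε / 3 := by
    intro u hu
    calc K * u ≤ |K| * δ := by rw [abs_of_nonneg hK]; gcongr
      _ < _ := hKδ
  refine ⟨M, fun n hn => ?_⟩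
  obtain ⟨h1, h2⟩ := hM n hn
  have t1 := tail F _ _ _ (hx n) (hy n)
  have t2 := tail F _ _ _ hx' hy'
  have t1' := small _ h1
  have t2' := small (X' - ∑ i ∈ F, x' i) (by linarith)
  rw [dist_eq_norm]
  calc ‖∑' i, y n i - ∑' i, y' i‖
      = ‖(∑' i, y n i - ∑ i ∈ F, y n i) + (∑ i ∈ F, y n i - ∑ i ∈ F, y' i)
          - (∑' i, y' i - ∑ i ∈ F, y' i)‖ := by congr 1; ring
    _ ≤ _ := (norm_sub_le _ _).trans (add_le_add_left (norm_add_le _ _) _)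
    _ < ε := by linarith

/-! ### States, trace norm, and the passage from weak to trace-norm convergence -/

section Trace
variable {H : Type*} [NormedAddCommGroup H] [InnerProductSpace ℂ H]

lemma hasSum_norm_inner_sq {ι : Type*} (b : HilbertBasis ι ℂ H) (x : H) :
    HasSum (fun i => ‖inner ℂ (b i) x‖ ^ 2) (‖x‖ ^ 2) := by
  have h := (b.hasSum_inner_mul_inner x x).mapL Complex.reCLM
  convert h using 1
  · ext i
    rw [Complex.reCLM_apply]
    have := inner_mul_symm_re_eq_norm (𝕜 := ℂ) x (b i)
    rw [norm_mul, norm_inner_symm x, ← sq] at this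
    exact this.symm
  · rw [Complex.reCLM_apply]
    exact (inner_self_eq_norm_sq (𝕜 := ℂ) x).symm

lemma summable_prod_norm_inner_sq {ι κ : Type*} (b : HilbertBasis ι ℂ H) {v : κ → H}
    (hv : Summable fun k => ‖v k‖ ^ 2) :
    Summable fun p : κ × ι => ‖inner ℂ (b p.2) (v p.1)‖ ^ 2 := by
  rw [summable_prod_of_nonneg fun p => by positivity]
  exact ⟨fun k => (hasSum_norm_inner_sq b (v k)).summable, by
    simpa only [(hasSum_norm_inner_sq b (v _)).tsum_eq] using hv⟩

variable [CompleteSpace H]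

/-- If `A` and `B` are Hilbert–Schmidt, then `tr(A B) = tr(B A)`. -/
lemma hasSum_inner_adjoint_comm {ι : Type*} (b : HilbertBasis ι ℂ H) (A B : H →L[ℂ] H)
    (hA : Summable fun i => ‖A (b i)‖ ^ 2)
    (hB : Summable fun i => ‖(ContinuousLinearMap.adjoint B) (b i)‖ ^ 2) :
    HasSum (fun i => inner ℂ ((ContinuousLinearMap.adjoint A) (b i)) (B (b i)))
      (∑' i, inner ℂ ((ContinuousLinearMap.adjoint B) (b i)) (A (b i))) := by
  set B' := ContinuousLinearMap.adjoint B with hB'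
  -- Expanded in the basis, both traces are iterated sums of this one double series, which converges
  -- absolutely because `A` and `B` are Hilbert–Schmidt.
  set F : ι × ι → ℂ := fun p => inner ℂ (B' (b p.1)) (b p.2) * inner ℂ (b p.2) (A (b p.1))
  have hF : Summable F := by
    refine Summable.of_norm_bounded ((summable_prod_norm_inner_sq b hA).add
      (summable_prod_norm_inner_sq b hB)) fun p => ?_
    rw [norm_mul, norm_inner_symm (B' (b p.1)) (b p.2)]
    nlinarith [sq_nonneg (‖inner ℂ (b p.2) (B' (b p.1))‖ - ‖inner ℂ (b p.2) (A (b p.1))‖),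
      sq_nonneg ‖inner ℂ (b p.2) (B' (b p.1))‖, sq_nonneg ‖inner ℂ (b p.2) (A (b p.1))‖]
  have h1 : ∑' p, F p = ∑' i, inner ℂ (B' (b i)) (A (b i)) := by
    rw [hF.tsum_prod]
    exact tsum_congr fun i => (b.hasSum_inner_mul_inner (B' (b i)) (A (b i))).tsum_eq
  have h2 : HasSum (fun p : ι × ι => F p.swap) (∑' p, F p) :=
    (Equiv.prodComm ι ι).hasSum_iff.2 hF.hasSum
  rw [← h1]
  refine h2.prod_fiberwise fun k => ?_
  have e : (fun i => F (k, i).swap) = fun i =>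
      inner ℂ (ContinuousLinearMap.adjoint A (b k)) (b i) * inner ℂ (b i) (B (b k)) := by
    funext i
    simp only [F, Prod.swap, hB', ContinuousLinearMap.adjoint_inner_left]
    ring
  rw [e]
  exact b.hasSum_inner_mul_inner (ContinuousLinearMap.adjoint A (b k)) (B (b k))

/-- The expectation in a state is a mixture of vector states. -/
lemma IsState.exists_hasSum {Γ : H →L[ℂ] H} (hΓ : IsState Γ) :
    ∃ v : basisIndex H → H, HasSum (fun i => ‖v i‖ ^ 2) 1 ∧
      (∀ X : H →L[ℂ] H, HasSum (fun i => inner ℂ (v i) (X (v i))) (trace (Γ ∘L X))) ∧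
      ∀ X : H →L[ℂ] H, HasSum (fun i => inner ℂ (basis H i) (X (Γ (basis H i))))
        (trace (Γ ∘L X)) := by
  set b := basis H
  have hΓ0 : 0 ≤ Γ := (ContinuousLinearMap.nonneg_iff_isPositive Γ).2 hΓ.isPositive
  set S : H →L[ℂ] H := CFC.sqrt Γ
  have hSS : ∀ x, Γ x = S (S x) := fun x => by
    conv_lhs => rw [← CFC.sqrt_mul_sqrt_self Γ hΓ0]
    rfl
  have hSpos : S.IsPositive :=
    (ContinuousLinearMap.nonneg_iff_isPositive S).1 (CFC.sqrt_nonneg Γ)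
  have hadj : ContinuousLinearMap.adjoint S = S := hSpos.isSelfAdjoint.adjoint_eq
  have hsymm : ∀ x y, inner ℂ (S x) y = inner ℂ x (S y) := fun x y => by
    rw [← ContinuousLinearMap.adjoint_inner_left, hadj]
  have hterm : ∀ i, inner ℂ (b i) (Γ (b i)) = ((‖S (b i)‖ ^ 2 : ℝ) : ℂ) := fun i => by
    rw [hSS, ← hsymm, inner_self_eq_norm_sq_to_K]; push_cast; rfl
  have htr : ∑' i, ‖S (b i)‖ ^ 2 = 1 := by
    have h := hΓ.trace_eq_one
    simp only [trace] at h
    rw [tsum_congr hterm, ← Complex.ofReal_tsum] at h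
    exact_mod_cast h
  -- The value of the trace forces convergence: a divergent series would have `tsum` equal to `0`,
  -- not `1`. Thus `√Γ` is Hilbert–Schmidt, and the mixture consists of the vectors `√Γ eᵢ`.
  have hsum : Summable fun i => ‖S (b i)‖ ^ 2 := by
    by_contra h
    rw [tsum_eq_zero_of_not_summable h] at htr
    exact zero_ne_one htr
  have key : ∀ X : H →L[ℂ] H,
      HasSum (fun i => inner ℂ (S (b i)) (X (S (b i)))) (trace (Γ ∘L X)) := by
    intro X
    have hX : Summable fun i => ‖(ContinuousLinearMap.adjoint X) (S (b i))‖ ^ 2 :=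
      Summable.of_nonneg_of_le (fun _ => by positivity) (fun i => by
        rw [← mul_pow]
        exact pow_le_pow_left₀ (norm_nonneg _)
          ((ContinuousLinearMap.adjoint X).le_opNorm _) 2) (hsum.mul_left _)
    have h' := hasSum_inner_adjoint_comm b S (S ∘L X)
      hsum (by simpa [ContinuousLinearMap.adjoint_comp, hadj] using hX)
    have e : trace (Γ ∘L X) = ∑' i, inner ℂ (S (b i)) (S (X (b i))) := by
      simp only [trace]
      refine tsum_congr fun i => ?_
      rw [ContinuousLinearMap.comp_apply, hSS, ← hsymm]
    have e2 := h'.tsum_eq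
    simp only [hadj, ContinuousLinearMap.comp_apply] at e2
    have hs2 : Summable fun i => inner ℂ (S (b i)) (X (S (b i))) := by
      refine Summable.of_norm_bounded (hsum.mul_left ‖X‖) fun i => ?_
      calc _ ≤ ‖S (b i)‖ * ‖X (S (b i))‖ := norm_inner_le_norm _ _
        _ ≤ ‖S (b i)‖ * (‖X‖ * ‖S (b i)‖) := by gcongr; exact X.le_opNorm _
        _ = _ := by ring
    rw [e, e2]
    convert hs2.hasSum using 1
    refine tsum_congr fun i => ?_
    rw [ContinuousLinearMap.adjoint_comp, hadj, ContinuousLinearMap.comp_apply,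
      ContinuousLinearMap.adjoint_inner_left]
  refine ⟨fun i => S (b i), htr ▸ hsum.hasSum, key, fun X => ?_⟩
  have h := hasSum_inner_adjoint_comm b (X ∘L S) S
    (Summable.of_nonneg_of_le (fun _ => by positivity) (fun i => by
      rw [ContinuousLinearMap.comp_apply, ← mul_pow]
      exact pow_le_pow_left₀ (norm_nonneg _) (X.le_opNorm _) 2) (hsum.mul_left _))
    (by simpa [hadj] using hsum)
  rw [← (key X).tsum_eq]
  simp only [ContinuousLinearMap.adjoint_comp, hadj, ContinuousLinearMap.comp_apply] at h
  convert h using 2 with i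
  rw [hSS, hsymm, ContinuousLinearMap.adjoint_inner_left]

/-- A bound on `|tr(U T)|` for all contractions `U` is a bound on `tr |T|`. -/
lemma traceNorm_le {T : H →L[ℂ] H} (hT : IsSelfAdjoint T) {c : ℝ}
    (h : ∀ U : H →L[ℂ] H, ‖U‖ ≤ 1 → ∃ t : ℂ,
      HasSum (fun i => inner ℂ (basis H i) (U (T (basis H i)))) t ∧ ‖t‖ ≤ c) :
    traceNorm T ≤ ENNReal.ofReal c := by
  set b := basis H
  have key : ∀ (F : Finset (basisIndex H)) (δ : ℝ), 0 < δ →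
      ∑ i ∈ F, (inner ℂ (b i) (CFC.abs T (b i))).re ≤ c + F.card * δ := by
    intro F δ hδ
    -- A continuous substitute for the sign function, as needed by the functional calculus: `|f| ≤
    -- 1`, `f(x) x ≥ 0`, and `f(x) x` differs from `|x|` by at most `δ`. The error in a partial sum
    -- is `F.card * δ`, with `δ` chosen after `F`.
    set f : ℝ → ℝ := fun x => x / (|x| + δ) with hf
    have hden : ∀ x : ℝ, 0 < |x| + δ := fun x => by positivity
    have hfc : Continuous f := continuous_id.div (by fun_prop) fun x => (hden x).ne'
    set U : H →L[ℂ] H := cfc f T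
    have hU : ‖U‖ ≤ 1 := norm_cfc_le zero_le_one fun x _ => by
      rw [hf, Real.norm_eq_abs, abs_div, abs_of_pos (hden x)]
      exact (div_le_one (hden x)).2 (by linarith)
    have hUT : U * T = cfc (fun x => f x * x) T := by
      conv_lhs => rw [show U * T = cfc f T * cfc (fun x : ℝ => x) T by rw [cfc_id' ℝ T]]
      rw [cfc_mul f (fun x => x) T hfc.continuousOn continuousOn_id]
    have hpos : 0 ≤ U * T := by
      rw [hUT]
      refine cfc_nonneg fun x _ => ?_
      rw [hf]
      have : x / (|x| + δ) * x = x * x / (|x| + δ) := by ring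
      simp only [this]
      exact div_nonneg (mul_self_nonneg x) (hden x).le
    have hclose : ‖CFC.abs T - U * T‖ ≤ δ := by
      rw [hUT, CFC.abs_eq_cfc_norm T hT, ← cfc_sub (fun x : ℝ => ‖x‖) (fun x => f x * x) T
        (by fun_prop) (by fun_prop)]
      refine norm_cfc_le hδ.le fun x _ => ?_
      have e : ‖x‖ - f x * x = |x| * δ / (|x| + δ) := by
        rw [hf, Real.norm_eq_abs]
        have := (hden x).ne'
        field_simp
        nlinarith [sq_abs x]
      rw [e, Real.norm_eq_abs, abs_of_nonneg (by positivity), div_le_iff₀ (hden x)]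
      nlinarith [abs_nonneg x]
    obtain ⟨t, ht, htc⟩ := h U hU
    have hre : HasSum (fun i => (inner ℂ (b i) (U (T (b i)))).re) t.re :=
      ht.mapL Complex.reCLM
    have hp := (ContinuousLinearMap.nonneg_iff_isPositive _).1 hpos
    have h1 : ∑ i ∈ F, (inner ℂ (b i) (U (T (b i)))).re ≤ t.re :=
      sum_le_hasSum F (fun i _ => hp.re_inner_nonneg_right (b i)) hre
    have h2 : t.re ≤ c := (Complex.re_le_norm t).trans htc
    have h3 : ∀ i ∈ F, (inner ℂ (b i) (CFC.abs T (b i))).re ≤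
        (inner ℂ (b i) (U (T (b i)))).re + δ := by
      intro i _
      have e : inner ℂ (b i) (CFC.abs T (b i)) =
          inner ℂ (b i) (U (T (b i))) + inner ℂ (b i) ((CFC.abs T - U * T) (b i)) := by
        rw [← inner_add_right]; simp
      rw [e, Complex.add_re]
      gcongr
      refine (Complex.re_le_norm _).trans ((norm_inner_le_norm _ _).trans ?_)
      have := (CFC.abs T - U * T).le_opNorm (b i)
      rw [b.orthonormal.norm_eq_one i] at *
      linarith
    calc _ ≤ ∑ i ∈ F, ((inner ℂ (b i) (U (T (b i)))).re + δ) := Finset.sum_le_sum h3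
      _ = ∑ i ∈ F, (inner ℂ (b i) (U (T (b i)))).re + F.card * δ := by
        rw [Finset.sum_add_distrib, Finset.sum_const, nsmul_eq_mul]
      _ ≤ _ := by gcongr; exact h1.trans h2
  have habs := (ContinuousLinearMap.nonneg_iff_isPositive _).1 (CFC.abs_nonneg T)
  rw [traceNorm, ENNReal.tsum_eq_iSup_sum]
  refine iSup_le fun F => ?_
  rw [← ENNReal.ofReal_sum_of_nonneg (f := fun i => (inner ℂ (b i) (CFC.abs T (b i))).re)
    fun i _ => habs.re_inner_nonneg_right (b i)]
  refine ENNReal.ofReal_le_ofReal (le_of_forall_pos_le_add fun ε hε => ?_)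
  refine (key F (ε / (F.card + 1)) (by positivity)).trans ?_
  gcongr
  rw [mul_div_assoc', div_le_iff₀ (by positivity)]
  nlinarith

/-- The part of the expectation of `U` in a state which is lost by cutting off `U` with a
projection `E` is controlled by the expectation of `1 - E`. -/
lemma norm_trace_sub_trace_cutoff_le {Γ : H →L[ℂ] H} (hΓ : IsState Γ) {E U : H →L[ℂ] H}
    (hE : IsStarProjection E) (hU : ‖U‖ ≤ 1) {η : ℝ} (hη : 0 < η) :
    ‖trace (Γ ∘L U) - trace (Γ ∘L (E * U * E))‖ ≤
      η + η⁻¹ * (1 - (trace (Γ ∘L E)).re) := by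
  obtain ⟨v, hv, hX, -⟩ := hΓ.exists_hasSum
  have hadj : ContinuousLinearMap.adjoint E = E := hE.isSelfAdjoint.adjoint_eq
  have hsymm : ∀ x y, inner ℂ (E x) y = inner ℂ x (E y) := fun x y => by
    rw [← ContinuousLinearMap.adjoint_inner_left, hadj]
  have hidem : ∀ x, E (E x) = E x := fun x => congrArg (fun A : H →L[ℂ] H => A x)
    hE.isIdempotentElem
  have hEre : HasSum (fun i => (inner ℂ (v i) (E (v i))).re) (trace (Γ ∘L E)).re :=
    (hX E).mapL Complex.reCLM
  have hcompl : ∀ x, ‖x - E x‖ ^ 2 = ‖x‖ ^ 2 - (inner ℂ x (E x)).re := fun x => by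
    have h1 := norm_sub_sq (𝕜 := ℂ) x (E x)
    have h2 : ‖E x‖ ^ 2 = (inner ℂ x (E x)).re := by
      rw [← inner_self_eq_norm_sq (𝕜 := ℂ), hsymm, hidem]; rfl
    rw [h1, h2]
    simp only [RCLike.re_to_complex]
    ring
  have hEle : ∀ x, ‖E x‖ ≤ ‖x‖ := fun x => by
    have h2 : ‖E x‖ ^ 2 = (inner ℂ x (E x)).re := by
      rw [← inner_self_eq_norm_sq (𝕜 := ℂ), hsymm, hidem]; rfl
    have h3 := hcompl x
    exact (sq_le_sq₀ (norm_nonneg _) (norm_nonneg _)).1 (by nlinarith [sq_nonneg ‖x - E x‖])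
  have hUle : ∀ x, ‖U x‖ ≤ ‖x‖ := fun x => (U.le_opNorm x).trans (by
    nlinarith [norm_nonneg x])
  have hsum : HasSum (fun i => η * ‖v i‖ ^ 2 + η⁻¹ * (‖v i‖ ^ 2 - (inner ℂ (v i) (E (v i))).re))
      (η * 1 + η⁻¹ * (1 - (trace (Γ ∘L E)).re)) :=
    (hv.mul_left η).add ((hv.sub hEre).mul_left _)
  rw [mul_one] at hsum
  rw [← ((hX U).sub (hX (E * U * E))).tsum_eq]
  refine tsum_of_norm_bounded hsum fun i => ?_
  set x := v i
  -- This is `U - EUE = (1 - E) U + E U (1 - E)`. Each term is linear in `‖x - E x‖`; the weighted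
  -- inequality `2ab ≤ η a² + η⁻¹ b²` below trades it for the square, which is the expectation of `1
  -- - E`.
  have e : inner ℂ x (U x) - inner ℂ x ((E * U * E) x) =
      inner ℂ (x - E x) (U x) + inner ℂ (E x) (U (x - E x)) := by
    simp only [mul_apply_eq_comp, map_sub, inner_sub_left, inner_sub_right, hsymm]
    ring
  rw [e, ← hcompl]
  have h1 : ‖inner ℂ (x - E x) (U x)‖ ≤ ‖x - E x‖ * ‖x‖ :=
    (norm_inner_le_norm _ _).trans (by gcongr; exact hUle x)
  have h2 : ‖inner ℂ (E x) (U (x - E x))‖ ≤ ‖x‖ * ‖x - E x‖ :=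
    (norm_inner_le_norm _ _).trans (by gcongr; exacts [hEle x, hUle _])
  have h3 : 2 * (‖x - E x‖ * ‖x‖) ≤ η * ‖x‖ ^ 2 + η⁻¹ * ‖x - E x‖ ^ 2 := by
    have := mul_nonneg (inv_nonneg.2 hη.le) (sq_nonneg (η * ‖x‖ - ‖x - E x‖))
    have e2 : η⁻¹ * (η * ‖x‖ - ‖x - E x‖) ^ 2 =
        η * ‖x‖ ^ 2 - 2 * (‖x - E x‖ * ‖x‖) + η⁻¹ * ‖x - E x‖ ^ 2 := by
      field_simp
      ring
    linarith
  refine (norm_add_le _ _).trans ?_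
  linarith

/-- Expectations in a state are bounded by the operator norm. -/
lemma IsState.norm_trace_comp_le {Γ : H →L[ℂ] H} (hΓ : IsState Γ) (X : H →L[ℂ] H) :
    ‖trace (Γ ∘L X)‖ ≤ ‖X‖ := by
  obtain ⟨v, hv, hX, -⟩ := hΓ.exists_hasSum
  rw [← (hX X).tsum_eq]
  refine tsum_of_norm_bounded (by simpa using hv.mul_left ‖X‖) fun i => ?_
  calc _ ≤ ‖v i‖ * ‖X (v i)‖ := norm_inner_le_norm _ _
    _ ≤ ‖v i‖ * (‖X‖ * ‖v i‖) := by gcongr; exact X.le_opNorm _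
    _ = _ := by ring

lemma trace_comp_rankOne (Γ : H →L[ℂ] H) (φ ψ : H) :
    trace (Γ ∘L InnerProductSpace.rankOne ℂ φ ψ) = inner ℂ ψ (Γ φ) := by
  rw [← ((basis H).hasSum_inner_mul_inner ψ (Γ φ)).tsum_eq]
  simp only [trace]
  refine tsum_congr fun i => ?_
  simp

lemma IsState.trace_comp_add {Γ : H →L[ℂ] H} (hΓ : IsState Γ) (X Y : H →L[ℂ] H) :
    trace (Γ ∘L (X + Y)) = trace (Γ ∘L X) + trace (Γ ∘L Y) := by
  obtain ⟨v, -, hX, -⟩ := hΓ.exists_hasSum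
  refine (hX (X + Y)).unique ?_
  simpa only [_root_.add_apply, inner_add_right] using (hX X).add (hX Y)

lemma IsState.trace_comp_smul {Γ : H →L[ℂ] H} (hΓ : IsState Γ) (c : ℂ) (X : H →L[ℂ] H) :
    trace (Γ ∘L (c • X)) = c * trace (Γ ∘L X) := by
  obtain ⟨v, -, hX, -⟩ := hΓ.exists_hasSum
  refine (hX (c • X)).unique ?_
  simpa only [_root_.smul_apply, inner_smul_right] using (hX X).mul_left c

lemma IsState.trace_comp_sum {Γ : H →L[ℂ] H} (hΓ : IsState Γ) {κ : Type*} (F : Finset κ)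
    (X : κ → H →L[ℂ] H) :
    trace (Γ ∘L ∑ k ∈ F, X k) = ∑ k ∈ F, trace (Γ ∘L X k) := by
  obtain ⟨v, -, hX, -⟩ := hΓ.exists_hasSum
  refine (hX (∑ k ∈ F, X k)).unique ?_
  simpa only [_root_.sum_apply, inner_sum] using hasSum_sum fun k _ => hX (X k)

/-- The orthogonal projection onto the span of finitely many vectors of the chosen basis. -/
def cutoff (F : Finset (basisIndex H)) : H →L[ℂ] H :=
  ∑ i ∈ F, InnerProductSpace.rankOne ℂ (basis H i) (basis H i)

lemma cutoff_apply (F : Finset (basisIndex H)) (x : H) :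
    cutoff F x = ∑ i ∈ F, inner ℂ (basis H i) x • basis H i := by
  simp [cutoff]

lemma isStarProjection_cutoff (F : Finset (basisIndex H)) : IsStarProjection (cutoff F) := by
  classical
  constructor
  · ext x
    rw [mul_apply_eq_comp]
    conv_lhs => rw [cutoff_apply]
    rw [cutoff_apply F x]
    refine Finset.sum_congr rfl fun i hi => ?_
    rw [inner_sum]
    simp [inner_smul_right, orthonormal_iff_ite.1 (basis H).orthonormal, hi]
  · rw [cutoff]
    refine isSelfAdjoint_sum _ fun i _ => ?_
    rw [ContinuousLinearMap.isSelfAdjoint_iff', InnerProductSpace.adjoint_rankOne]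

lemma IsState.trace_comp_cutoff {Γ : H →L[ℂ] H} (hΓ : IsState Γ) (F : Finset (basisIndex H)) :
    trace (Γ ∘L cutoff F) = ∑ i ∈ F, inner ℂ (basis H i) (Γ (basis H i)) := by
  rw [cutoff, hΓ.trace_comp_sum]
  exact Finset.sum_congr rfl fun i _ => trace_comp_rankOne _ _ _

/-- After the cutoff only finitely many matrix elements of `Γ` matter, which is what lets weak
convergence act uniformly over contractions `U`. -/
lemma IsState.trace_comp_cutoff_conj {Γ : H →L[ℂ] H} (hΓ : IsState Γ)
    (F : Finset (basisIndex H)) (U : H →L[ℂ] H) :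
    trace (Γ ∘L (cutoff F * U * cutoff F)) =
      ∑ i ∈ F, ∑ j ∈ F, inner ℂ (basis H j) (U (basis H i)) *
        inner ℂ (basis H i) (Γ (basis H j)) := by
  have e : cutoff F * U * cutoff F = ∑ i ∈ F, ∑ j ∈ F,
      inner ℂ (basis H j) (U (basis H i)) •
        InnerProductSpace.rankOne ℂ (basis H j) (basis H i) := by
    ext x
    simp only [mul_apply_eq_comp, cutoff_apply, map_sum, map_smul, _root_.sum_apply,
      _root_.smul_apply, InnerProductSpace.rankOne_apply]
    refine Finset.sum_congr rfl fun i _ => ?_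
    rw [Finset.smul_sum]
    exact Finset.sum_congr rfl fun j _ => smul_comm _ _ _
  rw [e, hΓ.trace_comp_sum]
  refine Finset.sum_congr rfl fun i _ => ?_
  rw [hΓ.trace_comp_sum]
  exact Finset.sum_congr rfl fun j _ => by rw [hΓ.trace_comp_smul, trace_comp_rankOne]

/-- Weak convergence of states to a state implies convergence in the trace norm. -/
theorem tendsto_traceNorm_sub {Γn : ℕ → H →L[ℂ] H} {Γ : H →L[ℂ] H} (hΓn : ∀ n, IsState (Γn n))
    (hΓ : IsState Γ)
    (hlim : ∀ φ ψ, Tendsto (fun n => inner ℂ φ (Γn n ψ)) atTop (𝓝 (inner ℂ φ (Γ ψ)))) :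
    Tendsto (fun n => traceNorm (Γn n - Γ)) atTop (𝓝 0) := by
  set b := basis H with hb
  have main : ∀ η : ℝ, 0 < η → ∀ᶠ n in atTop, traceNorm (Γn n - Γ) ≤ ENNReal.ofReal (5 * η) := by
    intro η hη
    have h1 : HasSum (fun i => (inner ℂ (b i) (Γ (b i))).re) 1 := by
      obtain ⟨v, hv, hX, hX'⟩ := hΓ.exists_hasSum
      have h := (hX' 1).mapL Complex.reCLM
      have e : trace (Γ ∘L (1 : H →L[ℂ] H)) = 1 := hΓ.trace_eq_one
      simpa [e] using h
    -- Missing mass `η ^ 2` makes the cutoff cost `η + η⁻¹ * η ^ 2 = 2 * η` for each of the two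
    -- states; the finite block adds `η`, hence the total `5 * η`.
    have hη2 : (0 : ℝ) < η ^ 2 := by positivity
    obtain ⟨F, hF⟩ := (h1.eventually (lt_mem_nhds (show 1 - η ^ 2 < (1 : ℝ) by linarith))).exists
    have ev1 : ∀ᶠ n in atTop, 1 - η ^ 2 < ∑ i ∈ F, (inner ℂ (b i) (Γn n (b i))).re := by
      refine Tendsto.eventually ?_ (lt_mem_nhds hF)
      exact tendsto_finsetSum _ fun i _ => (Complex.continuous_re.tendsto _).comp (hlim _ _)
    have ev2 : ∀ᶠ n in atTop,
        ∑ i ∈ F, ∑ j ∈ F, ‖inner ℂ (b i) (Γn n (b j)) - inner ℂ (b i) (Γ (b j))‖ < η := by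
      refine Tendsto.eventually_lt_const hη ?_
      rw [show (0 : ℝ) = ∑ i ∈ F, ∑ j ∈ F, 0 by simp]
      exact tendsto_finsetSum _ fun i _ => tendsto_finsetSum _ fun j _ =>
        tendsto_iff_norm_sub_tendsto_zero.1 (hlim _ _)
    filter_upwards [ev1, ev2] with n hn1 hn2
    have hsa : IsSelfAdjoint (Γn n - Γ) :=
      (hΓn n).isPositive.isSelfAdjoint.sub hΓ.isPositive.isSelfAdjoint
    refine traceNorm_le hsa fun U hU => ⟨trace (Γn n ∘L U) - trace (Γ ∘L U), ?_, ?_⟩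
    · obtain ⟨-, -, -, h⟩ := (hΓn n).exists_hasSum
      obtain ⟨-, -, -, h'⟩ := hΓ.exists_hasSum
      simpa only [_root_.sub_apply, map_sub, inner_sub_right] using (h U).sub (h' U)
    · have c1 := norm_trace_sub_trace_cutoff_le (hΓn n) (isStarProjection_cutoff F) hU hη
      have c2 := norm_trace_sub_trace_cutoff_le hΓ (isStarProjection_cutoff F) hU hη
      have small : ∀ t : ℝ, 1 - η ^ 2 < t → η⁻¹ * (1 - t) ≤ η := fun t ht => by
        rw [inv_mul_le_iff₀ hη]; nlinarith
      rw [(hΓn n).trace_comp_cutoff, Complex.re_sum] at c1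
      rw [hΓ.trace_comp_cutoff, Complex.re_sum] at c2
      have s1 := small _ hn1
      have s2 := small _ hF
      have c3 : ‖trace (Γn n ∘L (cutoff F * U * cutoff F)) -
          trace (Γ ∘L (cutoff F * U * cutoff F))‖ ≤ η := by
        rw [(hΓn n).trace_comp_cutoff_conj, hΓ.trace_comp_cutoff_conj, ← Finset.sum_sub_distrib]
        refine ((norm_sum_le _ _).trans (Finset.sum_le_sum fun i _ => ?_)).trans hn2.le
        rw [← Finset.sum_sub_distrib]
        refine (norm_sum_le _ _).trans (Finset.sum_le_sum fun j _ => ?_)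
        rw [← mul_sub, norm_mul]
        refine mul_le_of_le_one_left (norm_nonneg _) ((norm_inner_le_norm _ _).trans ?_)
        have := U.le_opNorm (basis H i)
        rw [(basis H).orthonormal.norm_eq_one] at *
        linarith
      set A := trace (Γn n ∘L U)
      set B := trace (Γ ∘L U)
      set A' := trace (Γn n ∘L (cutoff F * U * cutoff F))
      set B' := trace (Γ ∘L (cutoff F * U * cutoff F))
      calc ‖A - B‖ = ‖(A - A') + (A' - B') - (B - B')‖ := by congr 1; ring
        _ ≤ ‖A - A'‖ + ‖A' - B'‖ + ‖B - B'‖ :=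
          (norm_sub_le _ _).trans (add_le_add_left (norm_add_le _ _) _)
        _ ≤ 5 * η := by linarith
  rw [ENNReal.tendsto_nhds_zero]
  intro ε hε
  obtain ⟨r, hr0, hr⟩ := ENNReal.lt_iff_exists_nnreal_btwn.1 hε
  have hr0' : (0 : ℝ) < r := by exact_mod_cast hr0
  filter_upwards [main (r / 5) (by positivity)] with n hn
  refine hn.trans (le_trans ?_ hr.le)
  rw [mul_div_cancel₀ _ (by norm_num)]
  simp

/-- Matrix elements of states which converge on a total set converge everywhere. -/
lemma tendsto_inner_of_total {Γn : ℕ → H →L[ℂ] H} {Γ : H →L[ℂ] H} (hΓn : ∀ n, IsState (Γn n))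
    (hΓ : IsState Γ) {A : Set H} (hA : ∀ x, (∀ a ∈ A, inner ℂ a x = 0) → x = 0)
    (hlim : ∀ φ ∈ A, ∀ ψ ∈ A,
      Tendsto (fun n => inner ℂ φ (Γn n ψ)) atTop (𝓝 (inner ℂ φ (Γ ψ)))) (φ ψ : H) :
    Tendsto (fun n => inner ℂ φ (Γn n ψ)) atTop (𝓝 (inner ℂ φ (Γ ψ))) := by
  -- The same bound for all states makes the matrix elements equicontinuous, so convergence extends
  -- from a dense subspace.
  have hbd : ∀ {Γ' : H →L[ℂ] H}, IsState Γ' → ∀ x y, ‖inner ℂ x (Γ' y)‖ ≤ ‖x‖ * ‖y‖ := by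
    intro Γ' h x y
    rw [← trace_comp_rankOne]
    exact (h.norm_trace_comp_le _).trans (by rw [InnerProductSpace.norm_rankOne, mul_comm])
  have htop : (Submodule.span ℂ A).topologicalClosure = ⊤ := by
    rw [Submodule.topologicalClosure_eq_top_iff, Submodule.eq_bot_iff]
    intro x hx
    exact hA x fun a ha => (Submodule.mem_orthogonal _ _).1 hx a (Submodule.subset_span ha)
  have dense : Dense (Submodule.span ℂ A : Set H) :=
    Submodule.dense_iff_topologicalClosure_eq_top.2 htop
  have span2 : ∀ φ ∈ Submodule.span ℂ A, ∀ ψ ∈ Submodule.span ℂ A,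
      Tendsto (fun n => inner ℂ φ (Γn n ψ)) atTop (𝓝 (inner ℂ φ (Γ ψ))) := by
    intro φ hφ ψ hψ
    refine Submodule.span_induction₂ (p := fun φ ψ _ _ =>
      Tendsto (fun n => inner ℂ φ (Γn n ψ)) atTop (𝓝 (inner ℂ φ (Γ ψ))))
      (fun x y hx hy => hlim x hx y hy) ?_ ?_ ?_ ?_ ?_ ?_ hφ hψ
    · intro y _; simp
    · intro x _; simp
    · intro x y z _ _ _ h1 h2; simpa only [inner_add_left] using h1.add h2
    · intro x y z _ _ _ h1 h2; simpa only [map_add, inner_add_right] using h1.add h2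
    · intro r x y _ _ h; simpa only [inner_smul_left] using h.const_mul _
    · intro r x y _ _ h; simpa only [map_smul, inner_smul_right] using h.const_mul _
  rw [Metric.tendsto_atTop]
  intro ε hε
  set K := ‖φ‖ + ‖ψ‖ + 1
  have hK : 0 < K := by positivity
  set δ := min 1 (ε / (5 * K))
  have hδ : 0 < δ := by positivity
  -- Two approximations cost `2 * (K * δ)` each, and the convergence on the dense subspace costs `K
  -- * δ`.
  have hδK : 5 * (K * δ) ≤ ε := by
    have : δ ≤ ε / (5 * K) := min_le_right _ _
    rw [le_div_iff₀ (by positivity)] at this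
    linarith
  obtain ⟨φ', hφ', hφd⟩ := Metric.mem_closure_iff.1 (dense φ) δ hδ
  obtain ⟨ψ', hψ', hψd⟩ := Metric.mem_closure_iff.1 (dense ψ) δ hδ
  rw [dist_eq_norm] at hφd hψd
  have approx : ∀ {Γ' : H →L[ℂ] H}, IsState Γ' →
      ‖inner ℂ φ (Γ' ψ) - inner ℂ φ' (Γ' ψ')‖ ≤ 2 * (K * δ) := by
    intro Γ' h
    have e : inner ℂ φ (Γ' ψ) - inner ℂ φ' (Γ' ψ') =
        inner ℂ (φ - φ') (Γ' ψ) + inner ℂ φ' (Γ' (ψ - ψ')) := by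
      simp only [map_sub, inner_sub_left, inner_sub_right]; ring
    have hφn : ‖φ'‖ ≤ K := by
      have : ‖φ'‖ ≤ ‖φ‖ + ‖φ - φ'‖ := by
        simpa [norm_sub_rev] using norm_sub_le φ (φ - φ')
      have : δ ≤ 1 := min_le_left _ _
      have := norm_nonneg ψ
      simp only [K]; linarith
    have hψn : ‖ψ‖ ≤ K := by
      have := norm_nonneg φ
      simp only [K]; linarith
    rw [e]
    refine (norm_add_le _ _).trans ?_
    have a1 := hbd h (φ - φ') ψ
    have a2 := hbd h φ' (ψ - ψ')
    have a3 : ‖φ - φ'‖ * ‖ψ‖ ≤ δ * K := by gcongr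
    have a4 : ‖φ'‖ * ‖ψ - ψ'‖ ≤ K * δ := by gcongr
    linarith
  obtain ⟨M, hM⟩ := Metric.tendsto_atTop.1 (span2 φ' hφ' ψ' hψ') (K * δ) (by positivity)
  refine ⟨M, fun n hn => ?_⟩
  have h1 := hM n hn
  have h2 := approx (hΓn n)
  have h3 := approx hΓ
  rw [dist_eq_norm] at h1 ⊢
  calc _ = ‖(inner ℂ φ (Γn n ψ) - inner ℂ φ' (Γn n ψ')) +
      (inner ℂ φ' (Γn n ψ') - inner ℂ φ' (Γ ψ')) -
      (inner ℂ φ (Γ ψ) - inner ℂ φ' (Γ ψ'))‖ := by congr 1; ring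
    _ ≤ _ := (norm_sub_le _ _).trans (add_le_add_left (norm_add_le _ _) _)
    _ < ε := by linarith

end Trace

/-! ### Products of one-body functions in `L²` -/

/-- A function on a product space whose integrals over all rectangles vanish is zero. -/
lemma ae_eq_zero_of_forall_setIntegral_prod {α β : Type*} [MeasurableSpace α] [MeasurableSpace β]
    {μ : Measure α} {ν : Measure β} [SigmaFinite μ] [SigmaFinite ν] {f : α × β → ℂ}
    (hf : ∀ S, MeasurableSet S → (μ.prod ν) S < ⊤ → IntegrableOn f S (μ.prod ν))
    (h0 : ∀ A B, MeasurableSet A → MeasurableSet B → μ A < ⊤ → ν B < ⊤ →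
      ∫ z in A ×ˢ B, f z ∂(μ.prod ν) = 0) : f =ᵐ[μ.prod ν] 0 := by
  -- On a rectangle `R` of finite measure, the sets over which `f` integrates to zero form a Dynkin
  -- class containing the measurable rectangles, a generating π-system. By σ-finiteness such `R`
  -- exhaust the space.
  have key : ∀ k, f =ᵐ[(μ.prod ν).restrict (spanningSets μ k ×ˢ spanningSets ν k)] 0 := by
    intro k
    set R := spanningSets μ k ×ˢ spanningSets ν k with hR
    have hRm : MeasurableSet R :=
      (measurableSet_spanningSets μ k).prod (measurableSet_spanningSets ν k)
    have hRf : (μ.prod ν) R < ⊤ := by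
      rw [hR, Measure.prod_prod]
      exact ENNReal.mul_lt_top (measure_spanningSets_lt_top μ k) (measure_spanningSets_lt_top ν k)
    have hint : Integrable f ((μ.prod ν).restrict R) := hf R hRm hRf
    have huniv : ∫ z, f z ∂(μ.prod ν).restrict R = 0 :=
      h0 _ _ (measurableSet_spanningSets μ k) (measurableSet_spanningSets ν k)
        (measure_spanningSets_lt_top μ k) (measure_spanningSets_lt_top ν k)
    refine hint.ae_eq_zero_of_forall_setIntegral_eq_zero fun S hS _ => ?_
    induction S, hS using MeasurableSpace.induction_on_inter generateFrom_prod.symm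
      isPiSystem_prod with
    | empty => simp
    | basic t ht =>
      obtain ⟨A, hA, B, hB, rfl⟩ := ht
      rw [Measure.restrict_restrict (hA.prod hB), hR, Set.prod_inter_prod]
      exact h0 _ _ (hA.inter (measurableSet_spanningSets μ k))
        (hB.inter (measurableSet_spanningSets ν k))
        ((measure_mono Set.inter_subset_right).trans_lt (measure_spanningSets_lt_top μ k))
        ((measure_mono Set.inter_subset_right).trans_lt (measure_spanningSets_lt_top ν k))
    | compl t ht ih =>
      have h := integral_add_compl ht hint
      rw [ih (by
        rw [Measure.restrict_apply ht]
        exact (measure_mono Set.inter_subset_right).trans_lt hRf), zero_add] at h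
      rw [h, huniv]
    | iUnion t hd hm ih =>
      have h := hasSum_integral_iUnion hm hd hint.integrableOn
      refine h.unique ?_
      have : (fun i => ∫ z in t i, f z ∂(μ.prod ν).restrict R) = fun _ => 0 := funext fun i =>
        ih i (by
          rw [Measure.restrict_apply (hm i)]
          exact (measure_mono Set.inter_subset_right).trans_lt hRf)
      rw [this]
      exact hasSum_zero
  have hU : ⋃ k, spanningSets μ k ×ˢ spanningSets ν k = Set.univ := by
    rw [Set.iUnion_prod_of_monotone (monotone_spanningSets μ) (monotone_spanningSets ν),
      iUnion_spanningSets, iUnion_spanningSets, Set.univ_prod_univ]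
  rw [← Measure.restrict_univ (μ := μ.prod ν), ← hU, EventuallyEq, ae_restrict_iUnion_iff]
  exact key

lemma tensor_ae {d n : ℕ} (f : OneBody d) (ψ : L2 d n) :
    tensor f ψ =ᵐ[volume] fun x => f (x 0) * ψ (fun i => x i.succ) :=
  (memLp_tensorFun f ψ).coeFn_toLp

lemma ae_head {d n : ℕ} {p : Pos d → Prop} (h : ∀ᵐ y, p y) :
    ∀ᵐ x : Fin (n + 1) → Pos d, p (x 0) :=
  (Measure.quasiMeasurePreserving_fst.comp
    (measurePreserving_split d n).quasiMeasurePreserving).ae h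

/-- The tensor product `f ↦ f ⊗ ψ`. -/
def tensorLeft {d n : ℕ} (ψ : L2 d n) : OneBody d →L[ℂ] L2 d (n + 1) :=
  LinearMap.mkContinuous
    { toFun := fun f => tensor f ψ
      map_add' := fun f g => by
        apply Lp.ext
        filter_upwards [tensor_ae (f + g) ψ, tensor_ae f ψ, tensor_ae g ψ,
          ae_head (Lp.coeFn_add f g), Lp.coeFn_add (tensor f ψ) (tensor g ψ)] with x a b c e k
        rw [a, k, Pi.add_apply, b, c, e, Pi.add_apply, add_mul]
      map_smul' := fun r f => by
        apply Lp.ext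
        filter_upwards [tensor_ae (r • f) ψ, tensor_ae f ψ,
          ae_head (Lp.coeFn_smul r f), Lp.coeFn_smul r (tensor f ψ)] with x a b e k
        rw [a, RingHom.id_apply, k, Pi.smul_apply, b, e, Pi.smul_apply, smul_eq_mul, smul_eq_mul,
          mul_assoc] }
    ‖ψ‖ fun f => by
      have : ‖(memLp_tensorFun f ψ).toLp‖ = ‖f‖ * ‖ψ‖ := by
        rw [Lp.norm_toLp, eLpNorm_tensorFun, ENNReal.toReal_mul, ← Lp.norm_def, ← Lp.norm_def]
      exact (this.trans (mul_comm _ _)).le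

lemma tensorLeft_apply {d n : ℕ} (ψ : L2 d n) (f : OneBody d) : tensorLeft ψ f = tensor f ψ := rfl

lemma inner_tensor {d n : ℕ} (f g : OneBody d) (ψ φ : L2 d n) :
    inner ℂ (tensor f ψ) (tensor g φ) = inner ℂ f g * inner ℂ ψ φ := by
  rw [L2.inner_def, L2.inner_def, L2.inner_def, ← integral_prod_mul,
    ← (measurePreserving_split d n).integral_comp'
      (f := MeasurableEquiv.piFinSuccAbove (fun _ : Fin (n + 1) => Pos d) 0)]
  refine integral_congr_ae ?_
  filter_upwards [tensor_ae f ψ, tensor_ae g φ] with x a b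
  rw [a, b]
  simp only [RCLike.inner_apply, map_mul]
  change _ = g (x 0) * (starRingEnd ℂ) (f (x 0)) *
    (φ (fun i => x i.succ) * (starRingEnd ℂ) (ψ fun i => x i.succ))
  ring

/-- Testing against products of indicator functions makes the integrals of `Φ` over all rectangles
of finite sides vanish. -/
lemma eq_zero_of_inner_tensor {d n : ℕ} {Φ : L2 d (n + 1)}
    (h : ∀ (f : OneBody d) (ψ : L2 d n), inner ℂ (tensor f ψ) Φ = 0) : Φ = 0 := by
  set e := MeasurableEquiv.piFinSuccAbove (fun _ : Fin (n + 1) => Pos d) 0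
  have he : MeasurePreserving e volume (volume.prod volume) := measurePreserving_split d n
  have hS : ∀ S, ∫ z in S, Φ (e.symm z) ∂(volume.prod volume) = ∫ x in e ⁻¹' S, Φ x := by
    intro S
    rw [← he.setIntegral_preimage_emb e.measurableEmbedding]
    simp
  have hz : (fun z => Φ (e.symm z)) =ᵐ[volume.prod volume] 0 := by
    refine ae_eq_zero_of_forall_setIntegral_prod (fun S hSm hSf => ?_) fun A B hA hB hAf hBf => ?_
    · rw [← he.integrableOn_comp_preimage e.measurableEmbedding]
      have : (fun z => Φ (e.symm z)) ∘ e = Φ := by ext x; simp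
      rw [this]
      exact integrableOn_Lp_of_measure_ne_top Φ (by norm_num)
        (by rw [he.measure_preimage hSm.nullMeasurableSet]; exact hSf.ne)
    · rw [hS]
      have hAB : MeasurableSet (e ⁻¹' (A ×ˢ B)) := e.measurable (hA.prod hB)
      have hABf : volume (e ⁻¹' (A ×ˢ B)) ≠ ⊤ := by
        rw [he.measure_preimage (hA.prod hB).nullMeasurableSet, Measure.prod_prod]
        exact (ENNReal.mul_lt_top hAf hBf).ne
      rw [← L2.inner_indicatorConstLp_one (𝕜 := ℂ) hAB hABf Φ]
      convert h (indicatorConstLp 2 hA hAf.ne 1) (indicatorConstLp 2 hB hBf.ne 1) using 2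
      apply Lp.ext
      filter_upwards [indicatorConstLp_coeFn (p := 2) (hs := hAB) (hμs := hABf) (c := (1 : ℂ)),
        tensor_ae (indicatorConstLp 2 hA hAf.ne (1 : ℂ)) (indicatorConstLp 2 hB hBf.ne (1 : ℂ)),
        ae_head (indicatorConstLp_coeFn (p := 2) (hs := hA) (hμs := hAf.ne) (c := (1 : ℂ))),
        ae_tail (indicatorConstLp_coeFn (p := 2) (hs := hB) (hμs := hBf.ne) (c := (1 : ℂ)))]
        with x a b k l
      rw [a, b, k, l]
      have hx : x ∈ e ⁻¹' (A ×ˢ B) ↔ x 0 ∈ A ∧ (fun i : Fin n => x i.succ) ∈ B := Iff.rfl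
      by_cases h1 : x 0 ∈ A <;> by_cases h2 : (fun i : Fin n => x i.succ) ∈ B <;>
        simp [Set.indicator, hx, h1, h2]
  apply Lp.ext
  filter_upwards [he.quasiMeasurePreserving.ae hz, Lp.coeFn_zero ℂ 2 (volume : Measure _)]
    with x hx h0
  rw [h0]
  simpa using hx

lemma orthonormal_tensor {ι κ : Type*} {d n : ℕ} (b : HilbertBasis ι ℂ (OneBody d))
    (c : HilbertBasis κ ℂ (L2 d n)) :
    Orthonormal ℂ fun p : ι × κ => tensor (b p.1) (c p.2) := by
  classical
  rw [orthonormal_iff_ite]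
  rintro ⟨i, j⟩ ⟨i', j'⟩
  rw [inner_tensor, orthonormal_iff_ite.1 b.orthonormal, orthonormal_iff_ite.1 c.orthonormal]
  by_cases h1 : i = i' <;> by_cases h2 : j = j' <;> simp [h1, h2]

/-- The products of the vectors of two Hilbert bases form a Hilbert basis. -/
def tensorBasis {ι κ : Type*} {d n : ℕ} (b : HilbertBasis ι ℂ (OneBody d))
    (c : HilbertBasis κ ℂ (L2 d n)) : HilbertBasis (ι × κ) ℂ (L2 d (n + 1)) :=
  HilbertBasis.mkOfOrthogonalEqBot (orthonormal_tensor b c) <| by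
    rw [Submodule.eq_bot_iff]
    intro Φ hΦ
    have h0 : ∀ i j, inner ℂ (tensor (b i) (c j)) Φ = 0 := fun i j =>
      (Submodule.mem_orthogonal _ _).1 hΦ _ (Submodule.subset_span ⟨(i, j), rfl⟩)
    have h1 : ∀ i ψ, inner ℂ (tensor (b i) ψ) Φ = 0 := fun i ψ => by
      rw [← ContinuousLinearMap.adjoint_inner_right, ← (c.hasSum_inner_mul_inner _ _).tsum_eq]
      simp [ContinuousLinearMap.adjoint_inner_right, h0]
    refine eq_zero_of_inner_tensor fun f ψ => ?_
    rw [← tensorLeft_apply, ← ContinuousLinearMap.adjoint_inner_right,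
      ← (b.hasSum_inner_mul_inner _ _).tsum_eq]
    simp [ContinuousLinearMap.adjoint_inner_right, tensorLeft_apply, h1]

lemma tensorBasis_apply {ι κ : Type*} {d n : ℕ} (b : HilbertBasis ι ℂ (OneBody d))
    (c : HilbertBasis κ ℂ (L2 d n)) (p : ι × κ) :
    tensorBasis b c p = tensor (b p.1) (c p.2) := by
  simp [tensorBasis]

/-- Parseval's identity in the product basis, with the sum over the second factor carried out first.
This is the source of the identity `∑ⱼ a†(hⱼ) a(hⱼ) = 𝒩`. -/
lemma hasSum_inner_adjoint_tensor {ι : Type*} {d n : ℕ} (b : HilbertBasis ι ℂ (OneBody d))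
    (Φ Ψ : L2 d (n + 1)) :
    HasSum (fun i => inner ℂ (ContinuousLinearMap.adjoint (tensor (n := n) (b i)) Φ)
      (ContinuousLinearMap.adjoint (tensor (b i)) Ψ)) (inner ℂ Φ Ψ) := by
  set c := basis (L2 d n)
  refine ((tensorBasis b c).hasSum_inner_mul_inner Φ Ψ).prod_fiberwise fun i => ?_
  simp only [tensorBasis_apply]
  have h := c.hasSum_inner_mul_inner (ContinuousLinearMap.adjoint (tensor (n := n) (b i)) Φ)
    (ContinuousLinearMap.adjoint (tensor (b i)) Ψ)
  simpa only [ContinuousLinearMap.adjoint_inner_left, ContinuousLinearMap.adjoint_inner_right]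
    using h

/-! ### Permutations and symmetric products -/

lemma permute_one (d : ℕ) {n : ℕ} (ψ : L2 d n) : permute d 1 ψ = ψ := by
  apply Lp.ext
  filter_upwards [permute_ae d (1 : Equiv.Perm (Fin n)) ψ] with x hx
  rw [hx]
  rfl

lemma inner_permute (d : ℕ) {n : ℕ} (σ : Equiv.Perm (Fin n)) (ψ φ : L2 d n) :
    inner ℂ (permute d σ ψ) φ = inner ℂ ψ (permute d σ⁻¹ φ) := by
  rw [← (permute d σ).inner_map_map ψ, permute_permute, mul_inv_cancel, permute_one]

/-- The permutation of `n + 1` variables which permutes the last `n` of them. -/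
def liftPerm {n : ℕ} (τ : Equiv.Perm (Fin n)) : Equiv.Perm (Fin (n + 1)) :=
  Equiv.Perm.decomposeFin.symm (0, τ)

lemma Statistics.sign_liftPerm (s : Statistics) {n : ℕ} (τ : Equiv.Perm (Fin n)) :
    s.sign (liftPerm τ) = s.sign τ := by
  cases s
  · simp [Statistics.sign, liftPerm, Equiv.Perm.decomposeFin.symm_sign]
  · rfl

lemma tensor_permute {d n : ℕ} (f : OneBody d) (τ : Equiv.Perm (Fin n)) (ψ : L2 d n) :
    tensor f (permute d τ ψ) = permute d (liftPerm τ) (tensor f ψ) := by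
  apply Lp.ext
  filter_upwards [tensor_ae f (permute d τ ψ), permute_ae d (liftPerm τ) (tensor f ψ),
    ae_tail (permute_ae d τ ψ),
    (measurePreserving_permute d (liftPerm τ)).quasiMeasurePreserving.ae (tensor_ae f ψ)]
    with x a b c e
  rw [a, b, c, e]
  simp [liftPerm]

lemma permute_swap_tensor {d n : ℕ} (f g : OneBody d) (ψ : L2 d n) :
    permute d (Equiv.swap 0 1) (tensor f (tensor g ψ)) = tensor g (tensor f ψ) := by
  apply Lp.ext
  filter_upwards [permute_ae d (Equiv.swap 0 1) (tensor f (tensor g ψ)),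
    (measurePreserving_permute d (Equiv.swap (0 : Fin (n + 2)) 1)).quasiMeasurePreserving.ae
      (tensor_ae f (tensor g ψ)),
    (measurePreserving_permute d (Equiv.swap (0 : Fin (n + 2)) 1)).quasiMeasurePreserving.ae
      (ae_tail (tensor_ae g ψ)),
    tensor_ae g (tensor f ψ), ae_tail (tensor_ae f ψ)] with x a b c e k
  rw [a, b, c, e, k]
  have h : ∀ i : Fin n, Equiv.swap (0 : Fin (n + 2)) 1 i.succ.succ = i.succ.succ := fun i =>
    Equiv.swap_apply_of_ne_of_ne (Fin.succ_ne_zero _) (by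
      rw [← Fin.succ_zero_eq_one]
      exact fun h => Fin.succ_ne_zero i (Fin.succ_injective _ h))
  simp only [h, Equiv.swap_apply_left, Fin.succ_zero_eq_one, Equiv.swap_apply_right]
  ring

/-- The unnormalized (anti)symmetrization. -/
def symmetrize (s : Statistics) (d n : ℕ) : L2 d n →L[ℂ] L2 d n :=
  ∑ σ : Equiv.Perm (Fin n), s.sign σ • (permute d σ).toContinuousLinearMap

lemma symmetrize_apply (s : Statistics) {d n : ℕ} (ψ : L2 d n) :
    symmetrize s d n ψ = ∑ σ : Equiv.Perm (Fin n), s.sign σ • permute d σ ψ := by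
  simp [symmetrize]

lemma symmetrize_permute (s : Statistics) {d n : ℕ} (τ : Equiv.Perm (Fin n)) (ψ : L2 d n) :
    symmetrize s d n (permute d τ ψ) = s.sign τ • symmetrize s d n ψ := by
  simp only [symmetrize_apply, permute_permute, Finset.smul_sum, smul_smul]
  refine Fintype.sum_equiv (Equiv.mulRight τ) _ _ fun σ => ?_
  rw [Equiv.coe_mulRight, s.sign_mul, mul_left_comm, s.sign_mul_self, mul_one]

lemma prodL2_apply (s : Statistics) {d n : ℕ} (f : OneBody d) (ψ : L2 d n) :
    prodL2 s f ψ = ((Real.sqrt (Nat.factorial 1 * Nat.factorial n * Nat.factorial (n + 1)) : ℂ)⁻¹) •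
      symmetrize s d (n + 1) (tensor f ψ) := by
  simp [prodL2, symmetrize_apply]

/-- A permutation of the last `n` variables is absorbed by the outer symmetrization at the price of
its sign, which cancels the sign already there; `n!` equal terms remain. -/
lemma symmetrize_tensor_symmetrize (s : Statistics) {d n : ℕ} (f : OneBody d) (ψ : L2 d n) :
    symmetrize s d (n + 1) (tensor f (symmetrize s d n ψ)) =
      (Nat.factorial n : ℂ) • symmetrize s d (n + 1) (tensor f ψ) := by
  rw [symmetrize_apply s ψ]
  simp only [map_sum, map_smul, tensor_permute, symmetrize_permute, s.sign_liftPerm, smul_smul,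
    s.sign_mul_self, one_smul, Finset.sum_const, Finset.card_univ, Fintype.card_perm,
    Fintype.card_fin]
  rw [Nat.cast_smul_eq_nsmul]

/-- Up to the same constants, both sides symmetrize tensors which differ by exchanging the first two
variables. -/
lemma prodL2_prodL2 (s : Statistics) {d n : ℕ} (f g : OneBody d) (ψ : L2 d n) :
    prodL2 s f (prodL2 s g ψ) =
      s.sign (Equiv.swap (0 : Fin (n + 2)) 1) • prodL2 s g (prodL2 s f ψ) := by
  simp only [prodL2_apply, map_smul, symmetrize_tensor_symmetrize]
  rw [← permute_swap_tensor g f ψ, symmetrize_permute]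
  simp only [smul_smul]
  congr 1
  ring

/-- The sign picked up when two neighbouring creation operators are exchanged. -/
def Statistics.exchange (s : Statistics) : ℂ :=
  match s with
  | .fermions => -1
  | .bosons => 1

lemma Statistics.sign_swap (s : Statistics) (n : ℕ) :
    s.sign (Equiv.swap (0 : Fin (n + 2)) 1) = s.exchange := by
  cases s <;> simp [Statistics.sign, Statistics.exchange]

lemma Statistics.norm_exchange (s : Statistics) : ‖s.exchange‖ = 1 := by
  cases s <;> simp [Statistics.exchange]

lemma Statistics.conj_exchange (s : Statistics) :
    (starRingEnd ℂ) s.exchange = s.exchange := by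
  cases s <;> simp [Statistics.exchange]

lemma Statistics.conj_sign (s : Statistics) {n : ℕ} (σ : Equiv.Perm (Fin n)) :
    (starRingEnd ℂ) (s.sign σ) = s.sign σ := by
  cases s <;> simp [Statistics.sign]

lemma Statistics.sign_inv (s : Statistics) {n : ℕ} (σ : Equiv.Perm (Fin n)) :
    s.sign σ⁻¹ = s.sign σ := by
  cases s <;> simp [Statistics.sign]

/-! ### Creation and annihilation operators on the sectors -/

lemma toL2_injective (s : Statistics) (d n : ℕ) : Function.Injective (toL2 s d n) :=
  Subtype.val_injective

lemma inner_toL2 (s : Statistics) (d n : ℕ) (ψ φ : Sector s d n) :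
    inner ℂ (toL2 s d n ψ) (toL2 s d n φ) = inner ℂ ψ φ := rfl

lemma permute_toL2 (s : Statistics) (d n : ℕ) (ψ : Sector s d n) (σ : Equiv.Perm (Fin n)) :
    permute d σ (toL2 s d n ψ) = s.sign σ • toL2 s d n ψ := ψ.2 σ

lemma toL2_createSector (s : Statistics) (d n : ℕ) (f : OneBody d) (ψ : Sector s d n) :
    toL2 s d (n + 1) (createSector s d n f ψ) = prodL2 s f (toL2 s d n ψ) := rfl

lemma createSector_exchange (s : Statistics) (d n : ℕ) (f g : OneBody d) (ψ : Sector s d n) :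
    createSector s d (n + 1) f (createSector s d n g ψ) =
      s.exchange • createSector s d (n + 1) g (createSector s d n f ψ) := by
  apply toL2_injective
  rw [map_smul]
  simp only [toL2_createSector]
  rw [prodL2_prodL2, s.sign_swap]

lemma inner_symmetrize (s : Statistics) {d n : ℕ} (ψ : L2 d n) (Φ : Sector s d n) :
    inner ℂ (symmetrize s d n ψ) (toL2 s d n Φ) =
      (Nat.factorial n : ℂ) * inner ℂ ψ (toL2 s d n Φ) := by
  rw [symmetrize_apply, sum_inner]
  simp only [inner_smul_left, inner_permute, permute_toL2, inner_smul_right, s.conj_sign,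
    s.sign_inv, ← mul_assoc, s.sign_mul_self, one_mul, Finset.sum_const, Finset.card_univ,
    Fintype.card_perm, Fintype.card_fin, nsmul_eq_mul]

/-- Against a symmetric `Φ` the symmetrization only contributes a factor `(n+1)!`, and `(n+1)! /
√(n! (n+1)!) = √(n+1)`. -/
lemma inner_createSector (s : Statistics) {d n : ℕ} (f : OneBody d) (ψ : Sector s d n)
    (Φ : Sector s d (n + 1)) :
    inner ℂ (createSector s d n f ψ) Φ =
      (Real.sqrt (n + 1) : ℂ) * inner ℂ (tensor f (toL2 s d n ψ)) (toL2 s d (n + 1) Φ) := by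
  rw [← inner_toL2, toL2_createSector, prodL2_apply, inner_smul_left, inner_symmetrize,
    ← mul_assoc]
  congr 1
  rw [map_inv₀, Complex.conj_ofReal, ← Complex.ofReal_natCast, ← Complex.ofReal_inv,
    ← Complex.ofReal_mul]
  congr 1
  have h1 : (0 : ℝ) < Nat.factorial n := by exact_mod_cast Nat.factorial_pos n
  have h2 : (0 : ℝ) < n + 1 := by positivity
  have e : (Nat.factorial 1 * Nat.factorial n * Nat.factorial (n + 1) : ℝ) =
      (n + 1) * (Nat.factorial n : ℝ) ^ 2 := by
    rw [Nat.factorial_succ n]; push_cast; simp; ring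
  rw [e, Real.sqrt_mul h2.le, Real.sqrt_sq h1.le, Nat.factorial_succ n]
  push_cast
  have h3 : Real.sqrt (n + 1 : ℝ) ≠ 0 := (Real.sqrt_pos.2 h2).ne'
  field_simp
  rw [Real.sq_sqrt h2.le]

/-- The annihilation operator `a(f) : 𝔥ⁿ⁺¹ → 𝔥ⁿ`. -/
def annihilateSector (s : Statistics) (d n : ℕ) (f : OneBody d) :
    Sector s d (n + 1) →L[ℂ] Sector s d n :=
  ContinuousLinearMap.adjoint (createSector s d n f)

lemma adjoint_tensor_mem (s : Statistics) {d n : ℕ} (f : OneBody d) (Φ : Sector s d (n + 1)) :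
    ContinuousLinearMap.adjoint (tensor f) (toL2 s d (n + 1) Φ) ∈ symmetricSubspace s d n := by
  intro τ
  refine ext_inner_left ℂ fun ψ => ?_
  rw [show τ = τ⁻¹⁻¹ from (inv_inv τ).symm, ← inner_permute, inner_smul_right,
    ContinuousLinearMap.adjoint_inner_right, ContinuousLinearMap.adjoint_inner_right,
    tensor_permute, inner_permute, permute_toL2, inner_smul_right, s.sign_inv, s.sign_liftPerm,
    inv_inv, s.sign_inv]

lemma toL2_annihilateSector (s : Statistics) {d n : ℕ} (f : OneBody d)
    (Φ : Sector s d (n + 1)) :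
    toL2 s d n (annihilateSector s d n f Φ) =
      (Real.sqrt (n + 1) : ℂ) • ContinuousLinearMap.adjoint (tensor f) (toL2 s d (n + 1) Φ) := by
  set χ : Sector s d n := ⟨_, adjoint_tensor_mem s f Φ⟩ with hχ
  have e : annihilateSector s d n f Φ = (Real.sqrt (n + 1) : ℂ) • χ := by
    refine ext_inner_left ℂ fun ψ => ?_
    rw [annihilateSector, ContinuousLinearMap.adjoint_inner_right, inner_createSector,
      inner_smul_right, ← ContinuousLinearMap.adjoint_inner_right]
    rfl
  rw [e, map_smul]
  rfl

lemma inner_ofReal_smul_smul {E : Type*} [NormedAddCommGroup E] [InnerProductSpace ℂ E] (c : ℝ)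
    (x y : E) : inner ℂ ((c : ℂ) • x) ((c : ℂ) • y) = (c : ℂ) * (c : ℂ) * inner ℂ x y := by
  rw [inner_smul_left, inner_smul_right, Complex.conj_ofReal, mul_assoc]

lemma inner_annihilateSector (s : Statistics) {d n : ℕ} (f : OneBody d)
    (Φ Ψ : Sector s d (n + 1)) :
    inner ℂ (annihilateSector s d n f Φ) (annihilateSector s d n f Ψ) =
      (n + 1 : ℂ) * inner ℂ (ContinuousLinearMap.adjoint (tensor (n := n) f)
        (toL2 s d (n + 1) Φ)) (ContinuousLinearMap.adjoint (tensor f) (toL2 s d (n + 1) Ψ)) := by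
  have e : (Real.sqrt (n + 1) : ℂ) * (Real.sqrt (n + 1) : ℂ) = n + 1 := by
    rw [← Complex.ofReal_mul, Real.mul_self_sqrt (by positivity)]
    push_cast
    rfl
  refine (congrArg₂ (inner ℂ) (toL2_annihilateSector s f Φ)
    (toL2_annihilateSector s f Ψ)).trans ?_
  exact (inner_ofReal_smul_smul _ _ _).trans (congrArg (· * _) e)

/-- `∑ⱼ a†(hⱼ) a(hⱼ) = n + 1` on the sector of `n + 1` particles. -/
lemma hasSum_inner_annihilateSector (s : Statistics) {d n : ℕ} {ι : Type*}
    (b : HilbertBasis ι ℂ (OneBody d)) (Φ Ψ : Sector s d (n + 1)) :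
    HasSum (fun j => inner ℂ (annihilateSector s d n (b j) Φ) (annihilateSector s d n (b j) Ψ))
      ((n + 1 : ℂ) * inner ℂ Φ Ψ) := by
  have h := (hasSum_inner_adjoint_tensor b (toL2 s d (n + 1) Φ) (toL2 s d (n + 1) Ψ)).mul_left
    (n + 1 : ℂ)
  rw [inner_toL2] at h
  simp only [inner_annihilateSector]
  exact h

/-! ### The vacuum -/

lemma volume_fin_zero (d : ℕ) :
    (volume : Measure (Fin 0 → Pos d)) = Measure.dirac default := by
  rw [volume_pi, Measure.pi_of_empty]
  congr 1
  exact Subsingleton.elim _ _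

lemma vacuum_apply (s : Statistics) (d : ℕ) : ∀ x, toL2 s d 0 (vacuum s d) x = 1 := by
  have h : toL2 s d 0 (vacuum s d) =ᵐ[volume] fun _ => (1 : ℂ) :=
    MemLp.coeFn_toLp (show MemLp (fun _ : Fin 0 → Pos d => (1 : ℂ)) 2 volume by
      rw [volume_pi, Measure.pi_of_empty]
      exact memLp_const 1)
  intro x
  rw [Subsingleton.elim x default]
  have h' : ∀ᵐ y ∂(Measure.dirac (default : Fin 0 → Pos d)), toL2 s d 0 (vacuum s d) y = 1 :=
    volume_fin_zero d ▸ h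
  rwa [ae_dirac_eq] at h'

lemma inner_sector_zero (s : Statistics) (d : ℕ) (ψ φ : Sector s d 0) :
    inner ℂ ψ φ = inner ℂ (toL2 s d 0 ψ default) (toL2 s d 0 φ default) := by
  have h : ∀ g : (Fin 0 → Pos d) → ℂ, ∫ x, g x = g default := fun g => by
    rw [volume_fin_zero, integral_dirac]
  rw [← inner_toL2, L2.inner_def, h]

/-- The sector without particles is one-dimensional, so this is the resolution of the identity on
it. -/
lemma inner_eq_inner_vacuum (s : Statistics) (d : ℕ) (ψ φ : Sector s d 0) :
    inner ℂ ψ φ = inner ℂ ψ (vacuum s d) * inner ℂ (vacuum s d) φ := by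
  simp only [inner_sector_zero, vacuum_apply]
  simp [mul_comm]

/-! ### Operators on the truncated Fock space -/

section Fock
variable {s : Statistics} {d N : ℕ}

lemma fock_ext {Φ Ψ : Fock s d N} (h : ∀ n, component s d N n Φ = component s d N n Ψ) :
    Φ = Ψ :=
  (components s d N).injective (funext h)

lemma component_inclusion (n : Fin (N + 1)) (ψ : Sector s d n) :
    component s d N n (inclusion s d N n ψ) = ψ := by
  simp [component, inclusion]

lemma component_inclusion_of_ne {m n : Fin (N + 1)} (h : m ≠ n) (ψ : Sector s d n) :
    component s d N m (inclusion s d N n ψ) = 0 := by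
  simp [component, inclusion, h]

lemma inner_fock (Φ Ψ : Fock s d N) :
    inner ℂ Φ Ψ = ∑ n, inner ℂ (component s d N n Φ) (component s d N n Ψ) := rfl

lemma inner_inclusion (n : Fin (N + 1)) (ψ : Sector s d n) (Φ : Fock s d N) :
    inner ℂ (inclusion s d N n ψ) Φ = inner ℂ ψ (component s d N n Φ) := by
  rw [inner_fock, Finset.sum_eq_single n]
  · rw [component_inclusion]
  · intro m _ hm
    rw [component_inclusion_of_ne hm, inner_zero_left]
  · simp

lemma inner_inclusion_right (n : Fin (N + 1)) (ψ : Sector s d n) (Φ : Fock s d N) :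
    inner ℂ Φ (inclusion s d N n ψ) = inner ℂ (component s d N n Φ) ψ := by
  rw [← inner_conj_symm, inner_inclusion, inner_conj_symm]

lemma create_apply (f : OneBody d) (Φ : Fock s d N) :
    create s d N f Φ = ∑ n : Fin N, inclusion s d N n.succ
      (createSector s d n f (component s d N n.castSucc Φ)) := by
  simp only [create, _root_.sum_apply]
  rfl

lemma component_create_succ (f : OneBody d) (Φ : Fock s d N) (n : Fin N) :
    component s d N n.succ (create s d N f Φ) =
      createSector s d n f (component s d N n.castSucc Φ) := by
  rw [create_apply, map_sum, Finset.sum_eq_single n]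
  · exact component_inclusion n.succ _
  · intro m _ hm
    exact component_inclusion_of_ne (fun h => hm (Fin.succ_injective _ h).symm) _
  · simp

lemma component_create_zero (f : OneBody d) (Φ : Fock s d N) :
    component s d N 0 (create s d N f Φ) = 0 := by
  rw [create_apply, map_sum]
  exact Finset.sum_eq_zero fun m _ => component_inclusion_of_ne (Fin.succ_ne_zero m).symm _

lemma create_inclusion_castSucc (f : OneBody d) (n : Fin N) (ψ : Sector s d n.castSucc) :
    create s d N f (inclusion s d N n.castSucc ψ) =
      inclusion s d N n.succ (createSector s d n f ψ) := by
  rw [create_apply, Finset.sum_eq_single n]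
  · rw [component_inclusion]
  · intro m _ hm
    rw [component_inclusion_of_ne (fun h => hm (Fin.castSucc_injective _ h))]
    simp
  · simp

lemma create_inclusion_last (f : OneBody d) (ψ : Sector s d (Fin.last N)) :
    create s d N f (inclusion s d N (Fin.last N) ψ) = 0 := by
  rw [create_apply]
  refine Finset.sum_eq_zero fun m _ => ?_
  rw [component_inclusion_of_ne (Fin.castSucc_lt_last m).ne]
  simp

lemma inner_annihilate_right (f : OneBody d) (Φ Ψ : Fock s d N) :
    inner ℂ Φ (annihilate s d N f Ψ) = inner ℂ (create s d N f Φ) Ψ :=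
  ContinuousLinearMap.adjoint_inner_right _ _ _

lemma inner_annihilate_left (f : OneBody d) (Φ Ψ : Fock s d N) :
    inner ℂ (annihilate s d N f Φ) Ψ = inner ℂ Φ (create s d N f Ψ) :=
  ContinuousLinearMap.adjoint_inner_left _ _ _

lemma component_annihilate_castSucc (f : OneBody d) (Φ : Fock s d N) (n : Fin N) :
    component s d N n.castSucc (annihilate s d N f Φ) =
      annihilateSector s d n f (component s d N n.succ Φ) := by
  refine ext_inner_left ℂ fun ψ => ?_
  rw [← inner_inclusion, inner_annihilate_right, create_inclusion_castSucc, inner_inclusion]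
  exact (ContinuousLinearMap.adjoint_inner_right (createSector s d n f) ψ _).symm

lemma component_annihilate_last (f : OneBody d) (Φ : Fock s d N) :
    component s d N (Fin.last N) (annihilate s d N f Φ) = 0 := by
  refine ext_inner_left ℂ fun ψ => ?_
  rw [← inner_inclusion, inner_annihilate_right, create_inclusion_last, inner_zero_left,
    inner_zero_right]

/-! ### Functions of the number operator -/

variable (s d N) in
/-- The function `φ(𝒩)` of the number operator. -/
def numberFun (φ : ℕ → ℂ) : Fock s d N →L[ℂ] Fock s d N :=
  ∑ n : Fin (N + 1), φ n • (inclusion s d N n).comp (component s d N n)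

lemma component_numberFun (φ : ℕ → ℂ) (n : Fin (N + 1)) (Φ : Fock s d N) :
    component s d N n (numberFun s d N φ Φ) = φ n • component s d N n Φ := by
  simp only [numberFun, _root_.sum_apply, _root_.smul_apply, ContinuousLinearMap.comp_apply,
    map_sum, map_smul]
  rw [Finset.sum_eq_single n]
  · rw [component_inclusion]
  · intro m _ hm
    rw [component_inclusion_of_ne hm.symm, smul_zero]
  · simp

lemma numberFun_one : numberFun s d N (fun _ => 1) = 1 := by
  ext1 Φ
  exact fock_ext fun n => by rw [component_numberFun, one_smul]; rfl

lemma numberFun_add (φ χ : ℕ → ℂ) :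
    numberFun s d N (fun n => φ n + χ n) = numberFun s d N φ + numberFun s d N χ := by
  ext1 Φ
  exact fock_ext fun n => by
    rw [_root_.add_apply, map_add, component_numberFun, component_numberFun, component_numberFun,
      add_smul]

lemma numberFun_const (c : ℂ) : numberFun s d N (fun _ => c) = c • 1 := by
  ext1 Φ
  exact fock_ext fun n => by
    rw [_root_.smul_apply, map_smul, component_numberFun]; rfl

lemma inner_numberFun (φ : ℕ → ℂ) (Φ Ψ : Fock s d N) :
    inner ℂ Φ (numberFun s d N φ Ψ) =
      ∑ n : Fin (N + 1), φ n * inner ℂ (component s d N n Φ) (component s d N n Ψ) := by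
  rw [inner_fock]
  exact Finset.sum_congr rfl fun n _ => by rw [component_numberFun, inner_smul_right]

/-- `∑ⱼ a†(hⱼ) χ(𝒩) a(hⱼ) = 𝒩 χ(𝒩 - 1)`. -/
lemma hasSum_inner_annihilate {ι : Type*} (b : HilbertBasis ι ℂ (OneBody d)) (χ : ℕ → ℂ)
    (Φ Ψ : Fock s d N) :
    HasSum (fun j => inner ℂ (annihilate s d N (b j) Φ)
      (numberFun s d N χ (annihilate s d N (b j) Ψ)))
      (inner ℂ Φ (numberFun s d N (fun n => n * χ (n - 1)) Ψ)) := by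
  have e : inner ℂ Φ (numberFun s d N (fun n => n * χ (n - 1)) Ψ) =
      ∑ n : Fin N, χ n * ((n + 1 : ℂ) *
        inner ℂ (component s d N n.succ Φ) (component s d N n.succ Ψ)) := by
    -- The term `n = 0` is killed by the factor `n`, so the truncated subtraction `n - 1` only
    -- matters at successors.
    rw [inner_numberFun, Fin.sum_univ_succ]
    simp only [Fin.val_zero, Nat.cast_zero, zero_mul, zero_add, Fin.val_succ]
    refine Finset.sum_congr rfl fun n _ => ?_
    push_cast
    rw [mul_assoc, mul_left_comm]
  have e' : ∀ j, inner ℂ (annihilate s d N (b j) Φ)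
      (numberFun s d N χ (annihilate s d N (b j) Ψ)) =
      ∑ n : Fin N, χ n * inner ℂ (annihilateSector s d n (b j) (component s d N n.succ Φ))
        (annihilateSector s d n (b j) (component s d N n.succ Ψ)) := by
    intro j
    rw [inner_numberFun, Fin.sum_univ_castSucc, component_annihilate_last, inner_zero_left,
      mul_zero, add_zero]
    refine Finset.sum_congr rfl fun n _ => ?_
    rw [component_annihilate_castSucc, component_annihilate_castSucc]
    rfl
  rw [e]
  simp only [e']
  exact hasSum_sum fun n _ => (hasSum_inner_annihilateSector s b _ _).mul_left _

/-- Truncation respects this relation, as it cuts both sides in the same sectors. The relation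
between `a` and `a†` would fail in the top sector; only relations among creation operators and their
adjoints are used. -/
lemma create_exchange (f g : OneBody d) (Φ : Fock s d N) :
    create s d N f (create s d N g Φ) = s.exchange • create s d N g (create s d N f Φ) := by
  refine fock_ext fun m => ?_
  rw [map_smul]
  induction m using Fin.cases with
  | zero => rw [component_create_zero, component_create_zero, smul_zero]
  | succ n =>
    rw [component_create_succ, component_create_succ]
    cases N with
    | zero => exact n.elim0
    | succ M =>
      induction n using Fin.cases with
      | zero =>
        have h : ∀ f : OneBody d, component s d (M + 1) (Fin.castSucc 0)
            (create s d (M + 1) f Φ) = 0 := fun f => component_create_zero f Φ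
        rw [h, h, map_zero, map_zero, smul_zero]
      | succ k =>
        have h : ∀ f : OneBody d, component s d (M + 1) k.succ.castSucc
            (create s d (M + 1) f Φ) =
            createSector s d k f (component s d (M + 1) k.castSucc.castSucc Φ) :=
          fun f => component_create_succ f Φ k.castSucc
        rw [h, h]
        exact createSector_exchange s d k f g _

/-! ### Products of creation operators -/

variable (s d N) in
/-- `a†(f₁) ⋯ a†(f_q)`. -/
def createList (l : List (OneBody d)) : Fock s d N →L[ℂ] Fock s d N :=
  (l.map (create s d N)).prod

lemma createList_nil : createList s d N [] = 1 := rfl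

lemma createList_cons (f : OneBody d) (l : List (OneBody d)) :
    createList s d N (f :: l) = create s d N f * createList s d N l := by
  simp [createList]

lemma createList_cons_apply (f : OneBody d) (l : List (OneBody d)) (Φ : Fock s d N) :
    createList s d N (f :: l) Φ = create s d N f (createList s d N l Φ) := by
  rw [createList_cons]
  rfl

lemma createList_create (l : List (OneBody d)) (f : OneBody d) (Φ : Fock s d N) :
    createList s d N l (create s d N f Φ) =
      s.exchange ^ l.length • create s d N f (createList s d N l Φ) := by
  induction l with
  | nil => simp [createList_nil]
  | cons g l ih =>
    rw [createList_cons_apply, createList_cons_apply, ih, map_smul, create_exchange, smul_smul,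
      List.length_cons, pow_succ]

lemma component_createList_of_lt (l : List (OneBody d)) (Φ : Fock s d N) (n : Fin (N + 1))
    (h : (n : ℕ) < l.length) : component s d N n (createList s d N l Φ) = 0 := by
  induction l generalizing n with
  | nil => simp at h
  | cons f l ih =>
    rw [createList_cons_apply]
    induction n using Fin.cases with
    | zero => exact component_create_zero _ _
    | succ n =>
      rw [component_create_succ, ih _ (by simpa using h), map_zero]

/-- Each creation operator empties one more of the lowest sectors; this is where the recursion on
the length of products stops. -/
lemma createList_eq_zero {l : List (OneBody d)} (h : N < l.length) : createList s d N l = 0 := by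
  ext1 Φ
  refine fock_ext fun n => ?_
  rw [component_createList_of_lt l Φ n (by omega)]
  simp

lemma adjoint_createList_annihilate (l : List (OneBody d)) (f : OneBody d) (Φ : Fock s d N) :
    annihilate s d N f (ContinuousLinearMap.adjoint (createList s d N l) Φ) =
      s.exchange ^ l.length •
        ContinuousLinearMap.adjoint (createList s d N l) (annihilate s d N f Φ) := by
  refine ext_inner_left ℂ fun Ψ => ?_
  rw [inner_annihilate_right, ContinuousLinearMap.adjoint_inner_right, createList_create,
    inner_smul_left, inner_smul_right, ContinuousLinearMap.adjoint_inner_right,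
    inner_annihilate_right, map_pow, s.conj_exchange]

lemma adjoint_createList_cons (f : OneBody d) (l : List (OneBody d)) (Φ : Fock s d N) :
    ContinuousLinearMap.adjoint (createList s d N (f :: l)) Φ =
      ContinuousLinearMap.adjoint (createList s d N l) (annihilate s d N f Φ) := by
  refine ext_inner_left ℂ fun Ψ => ?_
  rw [ContinuousLinearMap.adjoint_inner_right, ContinuousLinearMap.adjoint_inner_right,
    inner_annihilate_right, createList_cons_apply]

lemma normalOrdered_eq {p q : ℕ} (f : Fin q → OneBody d) (g : Fin p → OneBody d) :
    normalOrdered s d N f g = createList s d N (List.ofFn f) *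
      ContinuousLinearMap.adjoint (createList s d N (List.ofFn g)) := by
  have h : ∀ l : List (OneBody d), (l.map (annihilate s d N)).reverse.prod =
      ContinuousLinearMap.adjoint (createList s d N l) := by
    intro l
    induction l with
    | nil => simp [createList_nil, ← ContinuousLinearMap.star_eq_adjoint]
    | cons a l ih =>
      ext1 Φ
      rw [List.map_cons, List.reverse_cons, List.prod_append, ih, adjoint_createList_cons]
      simp
  rw [← h, normalOrdered, createList, List.map_ofFn, List.map_ofFn]
  rfl

variable (s d N) in
/-- The vacuum vector of the truncated Fock space. -/
def fockVacuum : Fock s d N := inclusion s d N 0 (vacuum s d)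

lemma createList_ofFn_vacuum {q : ℕ} (hq : q < N + 1) (f : Fin q → OneBody d) :
    createList s d N (List.ofFn f) (fockVacuum s d N) =
      inclusion s d N ⟨q, hq⟩ (product s d q f) := by
  induction q with
  | zero => rfl
  | succ q ih =>
    rw [List.ofFn_succ, createList_cons_apply, ih (by omega)]
    exact create_inclusion_castSucc (f 0) (⟨q, by omega⟩ : Fin N) _

/-- The decomposition `φ(𝒩) = φ(0) |Ω⟩⟨Ω| + ∑ⱼ a†(hⱼ) χ(𝒩) a(hⱼ)`. -/
lemma hasSum_inner_numberFun_sub_vacuum {ι : Type*} (b : HilbertBasis ι ℂ (OneBody d))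
    (φ : ℕ → ℂ) (Φ Ψ : Fock s d N) :
    HasSum (fun j => inner ℂ (annihilate s d N (b j) Φ)
      (numberFun s d N (fun n => φ (n + 1) / (n + 1)) (annihilate s d N (b j) Ψ)))
      (inner ℂ Φ (numberFun s d N φ Ψ) -
        φ 0 * (inner ℂ Φ (fockVacuum s d N) * inner ℂ (fockVacuum s d N) Ψ)) := by
  convert hasSum_inner_annihilate b (fun n => φ (n + 1) / (n + 1)) Φ Ψ using 1
  have h0 : inner ℂ (component s d N 0 Φ) (component s d N 0 Ψ) =
      inner ℂ Φ (fockVacuum s d N) * inner ℂ (fockVacuum s d N) Ψ :=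
    (inner_eq_inner_vacuum s d _ _).trans (congrArg₂ (· * ·)
      (inner_inclusion_right 0 (vacuum s d) Φ).symm (inner_inclusion 0 (vacuum s d) Ψ).symm)
  rw [inner_numberFun, inner_numberFun, Fin.sum_univ_succ, Fin.sum_univ_succ, h0]
  simp only [Fin.val_zero, Nat.cast_zero, zero_mul, zero_add, Fin.val_succ, add_sub_cancel_left]
  refine Finset.sum_congr rfl fun n _ => ?_
  have : ((n : ℕ) + 1 : ℂ) ≠ 0 := Nat.cast_add_one_ne_zero _
  push_cast
  rw [mul_div_cancel₀ _ this]

/-! ### Induction on the particle number and totality of products -/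

/-- Vectors without components of `k` or more particles. -/
def SupportedBelow (k : ℕ) (Φ : Fock s d N) : Prop :=
  ∀ n : Fin (N + 1), k ≤ n → component s d N n Φ = 0

lemma supportedBelow_top (Φ : Fock s d N) : SupportedBelow (N + 1) Φ :=
  fun n hn => absurd n.isLt (by omega)

lemma SupportedBelow.eq_zero {Φ : Fock s d N} (h : SupportedBelow 0 Φ) : Φ = 0 :=
  fock_ext fun n => by rw [h n (Nat.zero_le _), map_zero]

lemma SupportedBelow.annihilate {k : ℕ} {Φ : Fock s d N} (h : SupportedBelow (k + 1) Φ)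
    (f : OneBody d) : SupportedBelow k (ManyBody.annihilate s d N f Φ) := by
  intro n hn
  induction n using Fin.lastCases with
  | last => exact component_annihilate_last f Φ
  | cast n =>
    rw [component_annihilate_castSucc, h n.succ (by simpa using hn), map_zero]

/-- The products of creation operators applied to the vacuum are total. -/
lemma eq_zero_of_inner_createList (Φ : Fock s d N)
    (h : ∀ l, inner ℂ (createList s d N l (fockVacuum s d N)) Φ = 0) : Φ = 0 := by
  have key : ∀ (k : ℕ) (Φ : Fock s d N), SupportedBelow k Φ →
      (∀ l, inner ℂ (createList s d N l (fockVacuum s d N)) Φ = 0) → Φ = 0 := by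
    intro k
    induction k with
    | zero => intro Φ hΦ _; exact hΦ.eq_zero
    | succ k ih =>
      intro Φ hΦ hl
      have ha : ∀ f, annihilate s d N f Φ = 0 := fun f => ih _ (hΦ.annihilate f) fun l => by
        rw [inner_annihilate_right, ← createList_cons_apply]
        exact hl _
      -- With `φ = 1` this expresses `‖Φ‖²` through the vacuum component and the vectors `a(hⱼ) Φ`,
      -- all of which vanish here.
      have hs := hasSum_inner_numberFun_sub_vacuum (basis (OneBody d)) (fun _ => 1) Φ Φ
      have hv : inner ℂ (fockVacuum s d N) Φ = 0 := hl []
      simp only [ha, inner_zero_left, hv, mul_zero, sub_zero, numberFun_one] at hs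
      have h0 := hs.unique hasSum_zero
      exact inner_self_eq_zero.1 h0
  exact key (N + 1) Φ (supportedBelow_top Φ) h

end Fock

section Density
variable {s : Statistics} {d N : ℕ}

lemma hasSum_norm_annihilate_sq {ι : Type*} (b : HilbertBasis ι ℂ (OneBody d)) (Φ : Fock s d N) :
    HasSum (fun j => ‖annihilate s d N (b j) Φ‖ ^ 2) (inner ℂ Φ (number s d N Φ)).re := by
  have h := (hasSum_inner_annihilate b (fun _ => 1) Φ Φ).mapL Complex.reCLM
  simp only [numberFun_one, mul_one] at h
  have e : ∀ x : Fock s d N, Complex.reCLM (inner ℂ x ((1 : Fock s d N →L[ℂ] Fock s d N) x)) =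
      ‖x‖ ^ 2 := fun x => inner_self_eq_norm_sq (𝕜 := ℂ) x
  simp only [e] at h
  exact h

lemma inner_number_le (Φ : Fock s d N) :
    (inner ℂ Φ (number s d N Φ)).re ≤ ‖number s d N‖ * ‖Φ‖ ^ 2 := by
  refine (Complex.re_le_norm _).trans ((norm_inner_le_norm _ _).trans ?_)
  calc ‖Φ‖ * ‖number s d N Φ‖ ≤ ‖Φ‖ * (‖number s d N‖ * ‖Φ‖) := by
        gcongr; exact (number s d N).le_opNorm _
    _ = _ := by ring

/-! ### Existence of density matrices -/

/-- A summable family of operators, bounded by a summable family, sums to an operator. -/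
lemma exists_hasSum_inner {E F : Type*} [NormedAddCommGroup E] [InnerProductSpace ℂ E]
    [NormedAddCommGroup F] [InnerProductSpace ℂ F] [CompleteSpace F] {ι : Type*}
    {D : ι → E →L[ℂ] F} {u : ι → ℝ} {U : ℝ} (hu : HasSum u U) (hD : ∀ i, ‖D i‖ ≤ u i) :
    ∃ D' : E →L[ℂ] F, ‖D'‖ ≤ U ∧
      ∀ x y, HasSum (fun i => inner ℂ x (D i y)) (inner ℂ x (D' y)) := by
  have hs : Summable D := Summable.of_norm_bounded hu.summable hD
  refine ⟨∑' i, D i, tsum_of_norm_bounded hu hD, fun x y => ?_⟩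
  exact (hs.hasSum.mapL (ContinuousLinearMap.apply ℂ F y)).mapL (innerSL ℂ x)

/-- Induction on the largest particle number in `v`. Splitting `φ(𝒩)` leaves a rank-one vacuum term
and a sum of the same expectations for the vectors `a(hⱼ) v`, which have one particle fewer. The
weight `φ` must be arbitrary, since it changes at each step. -/
lemma exists_densityMatrix_vector (p q : Fin (N + 1)) (k : ℕ) (φ : ℕ → ℂ) :
    ∃ C : ℝ, 0 ≤ C ∧ ∀ v : Fock s d N, SupportedBelow k v →
      ∃ D : Sector s d q →L[ℂ] Sector s d p, ‖D‖ ≤ C * ‖v‖ ^ 2 ∧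
        ∀ (f : Fin q → OneBody d) (g : Fin p → OneBody d),
          inner ℂ (product s d p g) (D (product s d q f)) =
            inner ℂ v (createList s d N (List.ofFn f) (numberFun s d N φ
              (ContinuousLinearMap.adjoint (createList s d N (List.ofFn g)) v))) := by
  induction k generalizing φ with
  | zero =>
    refine ⟨0, le_rfl, fun v hv => ⟨0, by simp, fun f g => ?_⟩⟩
    simp [hv.eq_zero]
  | succ k ih =>
    obtain ⟨C, hC, hD⟩ := ih fun n => φ (n + 1) / (n + 1)
    set K := ‖component s d N p‖ * ‖component s d N q‖
    refine ⟨‖φ 0‖ * K + C * ‖number s d N‖, by positivity, fun v hv => ?_⟩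
    set b := basis (OneBody d)
    -- The bounds `C * ‖a(hⱼ) v‖²` sum to `C ⟨v, 𝒩 v⟩`, so these operators are summable in norm.
    -- Moving `a(hⱼ)` past `q` and `p` annihilation operators produces the sign in the witness
    -- below.
    choose D hDn hDe using fun j => hD (annihilate s d N (b j) v) (hv.annihilate (b j))
    obtain ⟨D', hD'n, hD'⟩ := exists_hasSum_inner
      ((hasSum_norm_annihilate_sq b v).mul_left C) hDn
    refine ⟨φ 0 • InnerProductSpace.rankOne ℂ (component s d N p v) (component s d N q v) +
      s.exchange ^ ((q : ℕ) + p) • D', ?_, fun f g => ?_⟩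
    · refine (norm_add_le _ _).trans ?_
      rw [norm_smul, norm_smul, norm_pow, s.norm_exchange, one_pow, one_mul,
        InnerProductSpace.norm_rankOne]
      have h1 : ‖component s d N p v‖ * ‖component s d N q v‖ ≤ K * ‖v‖ ^ 2 :=
        calc _ ≤ (‖component s d N p‖ * ‖v‖) * (‖component s d N q‖ * ‖v‖) := by
              gcongr <;> exact ContinuousLinearMap.le_opNorm _ _
          _ = _ := by ring
      have h2 := mul_le_mul_of_nonneg_left h1 (norm_nonneg (φ 0))
      have h3 := mul_le_mul_of_nonneg_left (inner_number_le v) hC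
      calc _ ≤ ‖φ 0‖ * (K * ‖v‖ ^ 2) + C * (‖number s d N‖ * ‖v‖ ^ 2) := by linarith
        _ = _ := by ring
    · set A := createList s d N (List.ofFn f) with hA
      set B := createList s d N (List.ofFn g) with hB
      have hs := hasSum_inner_numberFun_sub_vacuum b φ (ContinuousLinearMap.adjoint A v)
        (ContinuousLinearMap.adjoint B v)
      have hs' := (hD' (product s d p g) (product s d q f)).mul_left
        (s.exchange ^ ((q : ℕ) + p))
      have e : ∀ j, inner ℂ (annihilate s d N (b j) (ContinuousLinearMap.adjoint A v))
          (numberFun s d N (fun n => φ (n + 1) / (n + 1))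
            (annihilate s d N (b j) (ContinuousLinearMap.adjoint B v))) =
          s.exchange ^ ((q : ℕ) + p) *
            inner ℂ (product s d p g) (D j (product s d q f)) := by
        intro j
        rw [hDe, hA, hB, adjoint_createList_annihilate, adjoint_createList_annihilate,
          inner_smul_left, map_smul, inner_smul_right, map_pow, s.conj_exchange,
          ContinuousLinearMap.adjoint_inner_left, List.length_ofFn, List.length_ofFn, pow_add,
          mul_assoc]
      simp only [e] at hs
      have e2 := hs.unique hs'
      have hAv : inner ℂ (ContinuousLinearMap.adjoint A v) (fockVacuum s d N) =
          inner ℂ (component s d N q v) (product s d q f) := by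
        rw [ContinuousLinearMap.adjoint_inner_left, hA, createList_ofFn_vacuum q.isLt]
        exact inner_inclusion_right q _ _
      have hBv : inner ℂ (fockVacuum s d N) (ContinuousLinearMap.adjoint B v) =
          inner ℂ (product s d p g) (component s d N p v) := by
        rw [ContinuousLinearMap.adjoint_inner_right, hB, createList_ofFn_vacuum p.isLt]
        exact inner_inclusion p _ _
      rw [hAv, hBv, ContinuousLinearMap.adjoint_inner_left] at e2
      rw [_root_.add_apply, inner_add_right, _root_.smul_apply, inner_smul_right,
        _root_.smul_apply, inner_smul_right, InnerProductSpace.rankOne_apply, inner_smul_right,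
        ← e2]
      ring

lemma exists_isDensityMatrix {Γ : Fock s d N →L[ℂ] Fock s d N} (hΓ : IsState Γ) {p q : ℕ}
    (hp : p ≤ N) (hq : q ≤ N) : ∃ D, IsDensityMatrix Γ p q D := by
  obtain ⟨v, hv, hX, -⟩ := hΓ.exists_hasSum
  obtain ⟨C, -, hD⟩ := exists_densityMatrix_vector (s := s) (d := d)
    (⟨p, by omega⟩ : Fin (N + 1)) ⟨q, by omega⟩ (N + 1) (fun _ => 1)
  choose D hDn hDe using fun i => hD (v i) (supportedBelow_top _)
  obtain ⟨D', -, hD'⟩ := exists_hasSum_inner (hv.mul_left C) hDn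
  refine ⟨D', fun f g => ?_⟩
  refine (hD' (product s d p g) (product s d q f)).unique ?_
  have e : (fun i => inner ℂ (product s d p g) (D i (product s d q f))) =
      fun i => inner ℂ (v i) (normalOrdered s d N f g (v i)) := funext fun i => by
    rw [hDe, numberFun_one, normalOrdered_eq]
    rfl
  rw [e]
  exact hX _

/-- Geometric convergence, in terms of expectations of normal-ordered products. -/
lemma GeometricallyConverges.tendsto_trace {Γn : ℕ → Fock s d N →L[ℂ] Fock s d N}
    {Γ : Fock s d N →L[ℂ] Fock s d N} (hΓn : ∀ n, IsState (Γn n)) (hΓ : IsState Γ)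
    (hconv : GeometricallyConverges Γn Γ) (l m : List (OneBody d)) :
    Tendsto (fun n => trace (Γn n ∘L (createList s d N l *
        ContinuousLinearMap.adjoint (createList s d N m)))) atTop
      (𝓝 (trace (Γ ∘L (createList s d N l *
        ContinuousLinearMap.adjoint (createList s d N m))))) := by
  -- Geometric convergence only concerns `p, q ≤ N`; longer products are zero.
  by_cases hl : N < l.length
  · simp [createList_eq_zero hl, trace]
  by_cases hm : N < m.length
  · simp [createList_eq_zero hm, trace]
  have hdm : ∀ {Γ' : Fock s d N →L[ℂ] Fock s d N}, IsState Γ' →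
      inner ℂ (product s d m.length m.get)
        (densityMatrix Γ' m.length l.length (product s d l.length l.get)) =
      trace (Γ' ∘L (createList s d N l * ContinuousLinearMap.adjoint (createList s d N m))) := by
    intro Γ' h
    -- Whichever operator was chosen, its values on products are prescribed, so uniqueness is not
    -- needed.
    have hex := exists_isDensityMatrix h (not_lt.1 hm) (not_lt.1 hl)
    rw [densityMatrix, dif_pos hex, hex.choose_spec l.get m.get, normalOrdered_eq,
      List.ofFn_get, List.ofFn_get]
  have h := hconv m.length (not_lt.1 hm) l.length (not_lt.1 hl)
    (product s d m.length m.get) (product s d l.length l.get)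
  simpa only [hdm (hΓn _), hdm hΓ] using h

end Density

/-! ### Expectations in a state -/

/-- With `A = a(hⱼ)` this supplies the domination by occupation numbers. -/
lemma IsState.norm_trace_conj_le {H : Type*} [NormedAddCommGroup H] [InnerProductSpace ℂ H]
    [CompleteSpace H] {Γ : H →L[ℂ] H} (hΓ : IsState Γ) (A X : H →L[ℂ] H) :
    ‖trace (Γ ∘L (ContinuousLinearMap.adjoint A * X * A))‖ ≤
      ‖X‖ * (trace (Γ ∘L (ContinuousLinearMap.adjoint A * A))).re := by
  obtain ⟨v, -, hX, -⟩ := hΓ.exists_hasSum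
  have h := (hX (ContinuousLinearMap.adjoint A * A)).mapL Complex.reCLM
  rw [← (hX _).tsum_eq]
  refine tsum_of_norm_bounded (h.mul_left ‖X‖) fun i => ?_
  have e1 : inner ℂ (v i) ((ContinuousLinearMap.adjoint A * X * A) (v i)) =
      inner ℂ (A (v i)) (X (A (v i))) := ContinuousLinearMap.adjoint_inner_right _ _ _
  have e2 : Complex.reCLM (inner ℂ (v i) ((ContinuousLinearMap.adjoint A * A) (v i))) =
      ‖A (v i)‖ ^ 2 := by
    rw [mul_apply_eq_comp, ContinuousLinearMap.adjoint_inner_right]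
    exact inner_self_eq_norm_sq (𝕜 := ℂ) _
  rw [e1, e2]
  calc _ ≤ ‖A (v i)‖ * ‖X (A (v i))‖ := norm_inner_le_norm _ _
    _ ≤ ‖A (v i)‖ * (‖X‖ * ‖A (v i)‖) := by gcongr; exact X.le_opNorm _
    _ = _ := by ring

/-! ### Occupation numbers and limits of expectations -/

section Convergence
variable {s : Statistics} {d N : ℕ}

lemma adjoint_annihilate (f : OneBody d) :
    ContinuousLinearMap.adjoint (annihilate s d N f) = create s d N f :=
  ContinuousLinearMap.adjoint_adjoint _

lemma summable_norm_annihilate_sq {ι κ : Type*} (b : HilbertBasis ι ℂ (OneBody d))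
    {v : κ → Fock s d N} (hv : Summable fun i => ‖v i‖ ^ 2)
    (B : Fock s d N →L[ℂ] Fock s d N) :
    Summable fun p : κ × ι => ‖annihilate s d N (b p.2) (B (v p.1))‖ ^ 2 := by
  rw [summable_prod_of_nonneg fun p => by positivity]
  refine ⟨fun i => (hasSum_norm_annihilate_sq b (B (v i))).summable, ?_⟩
  simp only [(hasSum_norm_annihilate_sq b _).tsum_eq]
  refine Summable.of_nonneg_of_le (fun i => ?_) (fun i => ?_)
    (hv.mul_left (‖number s d N‖ * ‖B‖ ^ 2))
  · exact (hasSum_norm_annihilate_sq b (B (v i))).nonneg fun _ => by positivity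
  · refine (inner_number_le _).trans ?_
    rw [mul_assoc, ← mul_pow]
    gcongr
    exact B.le_opNorm _

/-- Absolute convergence over mixture and one-body basis together, which permits exchanging the
trace with the sum over `j`. -/
lemma summable_inner_annihilate {ι κ : Type*} (b : HilbertBasis ι ℂ (OneBody d))
    {v : κ → Fock s d N} (hv : Summable fun i => ‖v i‖ ^ 2)
    (A B X : Fock s d N →L[ℂ] Fock s d N) :
    Summable fun p : κ × ι => inner ℂ (annihilate s d N (b p.2) (A (v p.1)))
      (X (annihilate s d N (b p.2) (B (v p.1)))) := by
  refine Summable.of_norm_bounded (((summable_norm_annihilate_sq b hv A).add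
    (summable_norm_annihilate_sq b hv B)).mul_left ‖X‖) fun p => ?_
  generalize annihilate s d N (b p.2) (A (v p.1)) = x
  generalize annihilate s d N (b p.2) (B (v p.1)) = y
  calc _ ≤ ‖x‖ * ‖X y‖ := norm_inner_le_norm _ _
    _ ≤ ‖x‖ * (‖X‖ * ‖y‖) := by gcongr; exact X.le_opNorm _
    _ = ‖X‖ * (‖x‖ * ‖y‖) := by ring
    _ ≤ _ := by
      gcongr
      nlinarith [sq_nonneg (‖x‖ - ‖y‖), sq_nonneg ‖x‖, sq_nonneg ‖y‖]

lemma hasSum_of_hasSum_prod {ι κ : Type*} {G : κ × ι → ℂ} (hG : Summable G) {x : κ → ℂ}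
    {y : ι → ℂ} {t : ℂ} (hx : ∀ i, HasSum (fun j => G (i, j)) (x i))
    (hy : ∀ j, HasSum (fun i => G (i, j)) (y j)) (ht : HasSum x t) : HasSum y t := by
  rw [ht.unique (hG.hasSum.prod_fiberwise hx)]
  have h : HasSum (fun p : ι × κ => G p.swap) (∑' p, G p) :=
    (Equiv.prodComm _ _).hasSum_iff.2 hG.hasSum
  exact h.prod_fiberwise hy

/-- `∑ⱼ tr(Γ A a†(hⱼ) χ(𝒩) a(hⱼ) B) = tr(Γ A 𝒩 χ(𝒩 - 1) B)`. -/
lemma IsState.hasSum_trace_create_annihilate {Γ : Fock s d N →L[ℂ] Fock s d N} (hΓ : IsState Γ)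
    {ι : Type*} (b : HilbertBasis ι ℂ (OneBody d)) (χ : ℕ → ℂ)
    (A B : Fock s d N →L[ℂ] Fock s d N) :
    HasSum (fun j => trace (Γ ∘L (A * create s d N (b j) * numberFun s d N χ *
        annihilate s d N (b j) * B)))
      (trace (Γ ∘L (A * numberFun s d N (fun n => n * χ (n - 1)) * B))) := by
  obtain ⟨v, hv, hX, -⟩ := hΓ.exists_hasSum
  refine hasSum_of_hasSum_prod (summable_inner_annihilate b hv.summable
    (ContinuousLinearMap.adjoint A) B (numberFun s d N χ)) (fun i => ?_) (fun j => ?_) (hX _)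
  · simp only [mul_apply_eq_comp]
    rw [← ContinuousLinearMap.adjoint_inner_left]
    exact hasSum_inner_annihilate b χ _ _
  · have h := hX (A * create s d N (b j) * numberFun s d N χ * annihilate s d N (b j) * B)
    simp only [mul_apply_eq_comp] at h
    simp only [inner_annihilate_left, ContinuousLinearMap.adjoint_inner_left]
    exact h

lemma IsState.averageNumber_eq {Γ : Fock s d N →L[ℂ] Fock s d N} (hΓ : IsState Γ) :
    averageNumber Γ = (trace (Γ ∘L number s d N)).re := by
  obtain ⟨-, -, -, h⟩ := hΓ.exists_hasSum
  rw [averageNumber, ← (h (number s d N)).tsum_eq]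
  rfl

/-- The average particle number is the sum of the average occupation numbers. -/
lemma IsState.hasSum_averageNumber {Γ : Fock s d N →L[ℂ] Fock s d N} (hΓ : IsState Γ)
    {ι : Type*} (b : HilbertBasis ι ℂ (OneBody d)) :
    HasSum (fun j => (trace (Γ ∘L (create s d N (b j) * annihilate s d N (b j)))).re)
      (averageNumber Γ) := by
  have h := (hΓ.hasSum_trace_create_annihilate b (fun _ => 1) 1 1).mapL Complex.reCLM
  simp only [numberFun_one, one_mul, mul_one] at h
  rw [hΓ.averageNumber_eq]
  exact h

lemma IsState.occupation_nonneg {Γ : Fock s d N →L[ℂ] Fock s d N} (hΓ : IsState Γ)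
    (f : OneBody d) : 0 ≤ (trace (Γ ∘L (create s d N f * annihilate s d N f))).re := by
  obtain ⟨v, -, hX, -⟩ := hΓ.exists_hasSum
  refine ((hX (create s d N f * annihilate s d N f)).mapL Complex.reCLM).nonneg fun i => ?_
  rw [mul_apply_eq_comp, ← inner_annihilate_left]
  exact inner_self_nonneg (𝕜 := ℂ)

lemma createList_mul_create (l : List (OneBody d)) (f : OneBody d) :
    createList s d N l * create s d N f =
      s.exchange ^ l.length • createList s d N (f :: l) := by
  ext1 Φ
  rw [_root_.smul_apply, createList_cons_apply]
  exact createList_create l f Φ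

lemma annihilate_mul_adjoint_createList (l : List (OneBody d)) (f : OneBody d) :
    annihilate s d N f * ContinuousLinearMap.adjoint (createList s d N l) =
      s.exchange ^ l.length • ContinuousLinearMap.adjoint (createList s d N (f :: l)) := by
  ext1 Φ
  rw [_root_.smul_apply, adjoint_createList_cons]
  exact adjoint_createList_annihilate l f Φ

lemma GeometricallyConverges.tendsto_occupation {Γn : ℕ → Fock s d N →L[ℂ] Fock s d N}
    {Γ : Fock s d N →L[ℂ] Fock s d N} (hΓn : ∀ n, IsState (Γn n)) (hΓ : IsState Γ)
    (hconv : GeometricallyConverges Γn Γ) (f : OneBody d) :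
    Tendsto (fun n => (trace (Γn n ∘L (create s d N f * annihilate s d N f))).re) atTop
      (𝓝 (trace (Γ ∘L (create s d N f * annihilate s d N f))).re) := by
  have h := hconv.tendsto_trace hΓn hΓ [f] [f]
  have e : createList s d N [f] = create s d N f := by
    rw [createList_cons, createList_nil, mul_one]
  rw [e] at h
  exact (Complex.continuous_re.tendsto _).comp h

/-- Fatou's lemma: finitely many modes nearly exhaust the limit, their occupations converge, and the
remaining modes only add to the average of `Γₙ`. -/
lemma GeometricallyConverges.averageNumber_le_liminf {Γn : ℕ → Fock s d N →L[ℂ] Fock s d N}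
    {Γ : Fock s d N →L[ℂ] Fock s d N} (hΓn : ∀ n, IsState (Γn n)) (hΓ : IsState Γ)
    (hconv : GeometricallyConverges Γn Γ) :
    ((averageNumber Γ : ℝ) : EReal) ≤
      liminf (fun n => ((averageNumber (Γn n) : ℝ) : EReal)) atTop := by
  set b := basis (OneBody d)
  refine le_of_forall_lt fun c hc => ?_
  obtain ⟨r, hcr, hr⟩ := EReal.lt_iff_exists_real_btwn.1 hc
  refine hcr.trans_le (le_liminf_of_le (by isBoundedDefault) ?_)
  have hr' : r < averageNumber Γ := by exact_mod_cast hr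
  obtain ⟨F, hF⟩ := ((hΓ.hasSum_averageNumber b).eventually (lt_mem_nhds hr')).exists
  have hlim := tendsto_finsetSum F fun j _ => hconv.tendsto_occupation hΓn hΓ (b j)
  filter_upwards [hlim.eventually (lt_mem_nhds hF)] with n hn
  have h := sum_le_hasSum F (fun j _ => (hΓn n).occupation_nonneg (b j))
    ((hΓn n).hasSum_averageNumber b)
  exact_mod_cast (hn.trans_le h).le

/-- Under convergence of the average particle number, the expectations of
`a†(f₁) ⋯ a†(f_q) φ(𝒩) a(g_p) ⋯ a(g₁)` converge. -/
lemma GeometricallyConverges.tendsto_trace_numberFun {Γn : ℕ → Fock s d N →L[ℂ] Fock s d N}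
    {Γ : Fock s d N →L[ℂ] Fock s d N} (hΓn : ∀ n, IsState (Γn n)) (hΓ : IsState Γ)
    (hconv : GeometricallyConverges Γn Γ)
    (hN : Tendsto (fun n => averageNumber (Γn n)) atTop (𝓝 (averageNumber Γ)))
    (φ : ℕ → ℂ) (l m : List (OneBody d)) :
    Tendsto (fun n => trace (Γn n ∘L (createList s d N l * numberFun s d N φ *
        ContinuousLinearMap.adjoint (createList s d N m)))) atTop
      (𝓝 (trace (Γ ∘L (createList s d N l * numberFun s d N φ *
        ContinuousLinearMap.adjoint (createList s d N m))))) := by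
  -- Induction on how many creation operators `l` still needs before its product vanishes; `φ`
  -- varies with the step.
  have key : ∀ k (l m : List (OneBody d)) (φ : ℕ → ℂ), N + 1 ≤ l.length + k →
      Tendsto (fun n => trace (Γn n ∘L (createList s d N l * numberFun s d N φ *
        ContinuousLinearMap.adjoint (createList s d N m)))) atTop
      (𝓝 (trace (Γ ∘L (createList s d N l * numberFun s d N φ *
        ContinuousLinearMap.adjoint (createList s d N m))))) := by
    intro k
    induction k with
    | zero =>
      intro l m φ h
      simp [createList_eq_zero (s := s) (show N < l.length by omega), trace]
    | succ k ih =>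
      intro l m φ h
      set b := basis (OneBody d)
      set A := createList s d N l with hA
      set B := ContinuousLinearMap.adjoint (createList s d N m) with hB
      -- Chosen so that `φ(n) = φ(0) + n χ(n - 1)` for all `n`. Unlike in the splitting with the
      -- vacuum projection, the first term is a multiple of the identity, hence accessible to
      -- geometric convergence.
      set χ : ℕ → ℂ := fun n => (φ (n + 1) - φ 0) / (n + 1) with hχ
      have hφ : numberFun s d N φ =
          φ 0 • 1 + numberFun s d N (fun n => n * χ (n - 1)) := by
        rw [← numberFun_const, ← numberFun_add]
        congr 1
        funext n
        cases n with
        | zero => simp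
        | succ n =>
          have : (n + 1 : ℂ) ≠ 0 := Nat.cast_add_one_ne_zero n
          simp only [hχ, Nat.add_sub_cancel, Nat.cast_add, Nat.cast_one]
          rw [mul_div_cancel₀ _ this]
          ring
      have split : ∀ {Γ' : Fock s d N →L[ℂ] Fock s d N}, IsState Γ' →
          trace (Γ' ∘L (A * numberFun s d N φ * B)) = φ 0 * trace (Γ' ∘L (A * B)) +
            ∑' j, trace (Γ' ∘L (A * create s d N (b j) * numberFun s d N χ *
              annihilate s d N (b j) * B)) := by
        intro Γ' h'
        rw [(h'.hasSum_trace_create_annihilate b χ A B).tsum_eq, ← h'.trace_comp_smul,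
          ← h'.trace_comp_add, hφ]
        congr 2
        simp [mul_add, add_mul]
      have term : ∀ j, A * create s d N (b j) * numberFun s d N χ * annihilate s d N (b j) * B =
          s.exchange ^ (l.length + m.length) • (createList s d N (b j :: l) * numberFun s d N χ *
            ContinuousLinearMap.adjoint (createList s d N (b j :: m))) := by
        intro j
        rw [mul_assoc _ _ B, hA, hB, createList_mul_create, annihilate_mul_adjoint_createList,
          pow_add]
        simp only [smul_mul_assoc, mul_smul_comm, smul_smul]
        rw [mul_comm (s.exchange ^ m.length)]
      -- In the form `a†(hⱼ) X a(hⱼ)` the middle operator `X` does not depend on `j`, so `‖X‖` is a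
      -- common constant for the domination.
      have term' : ∀ j, createList s d N (b j :: l) * numberFun s d N χ *
            ContinuousLinearMap.adjoint (createList s d N (b j :: m)) =
          ContinuousLinearMap.adjoint (annihilate s d N (b j)) * (A * numberFun s d N χ * B) *
            annihilate s d N (b j) := by
        intro j
        have e : ContinuousLinearMap.adjoint (createList s d N (b j :: m)) =
            B * annihilate s d N (b j) := by
          ext1 Φ
          exact adjoint_createList_cons _ _ _
        rw [e, createList_cons, adjoint_annihilate]
        simp only [mul_assoc, hA]
      have bound : ∀ {Γ' : Fock s d N →L[ℂ] Fock s d N}, IsState Γ' → ∀ j,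
          ‖trace (Γ' ∘L (A * create s d N (b j) * numberFun s d N χ *
              annihilate s d N (b j) * B))‖ ≤ ‖A * numberFun s d N χ * B‖ *
            (trace (Γ' ∘L (create s d N (b j) * annihilate s d N (b j)))).re := by
        intro Γ' h' j
        rw [term, h'.trace_comp_smul, norm_mul, norm_pow, s.norm_exchange, one_pow, one_mul,
          term', ← adjoint_annihilate]
        exact h'.norm_trace_conj_le _ _
      simp only [split hΓ, split (hΓn _)]
      refine ((hconv.tendsto_trace hΓn hΓ l m).const_mul _).add ?_
      refine tendsto_tsum_of_dominated_of_tendsto (norm_nonneg _)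
        (fun n => (hΓn n).hasSum_averageNumber b) (hΓ.hasSum_averageNumber b)
        (fun j => hconv.tendsto_occupation hΓn hΓ (b j)) hN (fun n => bound (hΓn n)) (bound hΓ)
        fun j => ?_
      simp only [term, hΓ.trace_comp_smul, (hΓn _).trace_comp_smul]
      exact (ih _ _ χ (by simp only [List.length_cons]; omega)).const_mul _
  exact key (N + 1) l m φ (by omega)

/-- For the indicator of `0` the shifted weight is zero, so the splitting of `φ(𝒩)` reduces to the
vacuum projection. This turns matrix elements between products into expectations. -/
lemma createList_mul_vacuum_mul (l m : List (OneBody d)) :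
    createList s d N l * numberFun s d N (fun n => if n = 0 then 1 else 0) *
        ContinuousLinearMap.adjoint (createList s d N m) =
      InnerProductSpace.rankOne ℂ (createList s d N l (fockVacuum s d N))
        (createList s d N m (fockVacuum s d N)) := by
  have h : ∀ Ψ, numberFun s d N (fun n => if n = 0 then 1 else 0) Ψ =
      inner ℂ (fockVacuum s d N) Ψ • fockVacuum s d N := by
    intro Ψ
    refine ext_inner_left ℂ fun Φ => ?_
    have hs := hasSum_inner_numberFun_sub_vacuum (basis (OneBody d))
      (fun n => if n = 0 then 1 else 0) Φ Ψ
    have h0 : numberFun s d N (fun n => (if n + 1 = 0 then (1 : ℂ) else 0) / (n + 1)) = 0 := by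
      simpa using numberFun_const (s := s) (d := d) (N := N) 0
    simp only [h0, _root_.zero_apply, inner_zero_right, if_true, one_mul] at hs
    rw [inner_smul_right, mul_comm]
    exact sub_eq_zero.1 (hs.unique hasSum_zero)
  ext1 Φ
  rw [mul_apply_eq_comp, mul_apply_eq_comp, h, map_smul, InnerProductSpace.rankOne_apply,
    ContinuousLinearMap.adjoint_inner_right]

end Convergence

end ManyBody
end

/-! ### The main theorem -/

theorem mainTheorem12 (s : ManyBody.Statistics) (d N : ℕ)
    (Γn : ℕ → ManyBody.Fock s d N →L[ℂ] ManyBody.Fock s d N)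
    (Γ : ManyBody.Fock s d N →L[ℂ] ManyBody.Fock s d N)
    (hΓn : ∀ n, ManyBody.IsState (Γn n)) (hΓ : ManyBody.IsState Γ)
    (hconv : ManyBody.GeometricallyConverges Γn Γ) :
    ((ManyBody.averageNumber Γ : ℝ) : EReal) ≤
        liminf (fun n => ((ManyBody.averageNumber (Γn n) : ℝ) : EReal)) atTop ∧
      (Tendsto (fun n => ManyBody.averageNumber (Γn n)) atTop (𝓝 (ManyBody.averageNumber Γ)) →
        Tendsto (fun n => ManyBody.traceNorm (Γn n - Γ)) atTop (𝓝 0)) := by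
  refine ⟨hconv.averageNumber_le_liminf hΓn hΓ, fun hN => ?_⟩
  refine ManyBody.tendsto_traceNorm_sub hΓn hΓ
    (ManyBody.tendsto_inner_of_total hΓn hΓ
      (A := Set.range fun l => ManyBody.createList s d N l (ManyBody.fockVacuum s d N))
      (fun x hx => ManyBody.eq_zero_of_inner_createList x fun l => hx _ ⟨l, rfl⟩) ?_)
  -- The matrix element between the products for `m` and `l` is the trace of the state against a
  -- rank-one operator, in which `l` creates and `m` annihilates around the vacuum projection.
  rintro _ ⟨m, rfl⟩ _ ⟨l, rfl⟩
  simpa only [ManyBody.createList_mul_vacuum_mul, ManyBody.trace_comp_rankOne] using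
    hconv.tendsto_trace_numberFun hΓn hΓ hN (fun n => if n = 0 then 1 else 0) l m
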